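/- Let $k$ be a field of characteristic zero, let $M$ be the noncommutative two-dimensional Lie algebra over $k$, and let $U(M)$ be its universal enveloping algebra. It is an Ore domain; let $\mathfrak{D}(M)\supseteq U(M)$ be its Ore division ring of fractions. The principal involution $x\mapsto -x$ of $M$ extends to a $k$-involution of $\mathfrak{D}(M)$ (a $k$-linear map $*$ with $(xy)^*=y^*x^*$ and $x^{**}=x$), which is called the principal involution of $\mathfrak{D}(M)$. The Lie algebra $M$ has a basis $\{e,f\}$ with $[e,f]=f$. For any such basis, define the elements $$s=\Bigl(e-\tfrac13\Bigr)\Bigl(e+\tfrac13\Bigr)^{-1},\qquad u=(1-f)(1+f)^{-1}$$ of $\mathfrak{D}(M)$. Then: 1. the elements $s+s^{-1}$ and $u(s+s^{-1})u^{-1}$ are symmetric with respect to the principal involution of $\mathfrak{D}(M)$, that is, they are fixed by it; 2. the $k$-subalgebra of $\mathfrak{D}(M)$ generated by $s+s^{-1}$ and $u(s+s^{-1})u^{-1}$ is the free associative $k$-algebra on the set $\{s+s^{-1},\ u(s+s^{-1})u^{-1}\}$, that is, the homomorphism of unital $k$-algebras from $k\langle X,Y\rangle$ to $\mathfrak{D}(M)$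 with $X\mapsto s+s^{-1}$ and $Y\mapsto u(s+s^{-1})u^{-1}$ is injective. -/

import Mathlib

open scoped nonZeroDivisors

/-! ### Ore domains -/

/-- A ring is an *Ore domain* if it is nonzero, has no zero divisors, and any two nonzero elements
satisfy the left and the right Ore condition. -/
class IsOreDomain (R : Type*) [Ring R] : Prop where
  nontrivial : Nontrivial R
  noZeroDivisors : NoZeroDivisors R
  left_ore : ∀ a s : R, s ≠ 0 → ∃ a' s' : R, s' ≠ 0 ∧ s' * a = a' * s
  right_ore : ∀ a s : R, s ≠ 0 → ∃ a' s' : R, s' ≠ 0 ∧ a * s' = s * a'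

namespace IsOreDomain

attribute [instance] IsOreDomain.nontrivial IsOreDomain.noZeroDivisors

/-- The nonzero elements of an Ore domain form an Ore set. -/
noncomputable instance oreSet (R : Type*) [Ring R] [IsOreDomain R] :
    OreLocalization.OreSet R⁰ :=
  (OreLocalization.nonempty_oreSet_iff_of_noZeroDivisors.2 (by
    intro r s
    obtain ⟨a', s', hs', h⟩ := IsOreDomain.left_ore r (s : R) (nonZeroDivisors.coe_ne_zero s)
    exact ⟨a', ⟨s', mem_nonZeroDivisors_of_ne_zero hs'⟩, h⟩)).some

end IsOreDomain

/-! ### The principal involution of an enveloping algebra -/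

section Enveloping

attribute [local instance 100] LieRing.ofAssociativeRing

variable (k : Type*) [Field k] (L : Type*) [LieRing L] [LieAlgebra k L]

namespace UniversalEnvelopingAlgebra

/-- The principal involution `x ↦ -x` of `L` as a Lie algebra homomorphism into the opposite of
the enveloping algebra. -/
noncomputable def principalLie : L →ₗ⁅k⁆ (UniversalEnvelopingAlgebra k L)ᵐᵒᵖ where
  toFun x := MulOpposite.op (-(ι k x))
  map_add' x y := by
    rw [map_add, neg_add, MulOpposite.op_add]
  map_smul' c x := by
    rw [map_smul, RingHom.id_apply, ← MulOpposite.op_smul, smul_neg]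
  map_lie' {x y} := by
    rw [LieHom.map_lie, LieRing.of_associative_ring_bracket, LieRing.of_associative_ring_bracket,
      ← MulOpposite.op_mul, ← MulOpposite.op_mul, ← MulOpposite.op_sub, neg_mul_neg, neg_mul_neg,
      neg_sub]

/-- The extension of the principal involution to the enveloping algebra, as an algebra
homomorphism into the opposite algebra. -/
noncomputable def principalHom :
    UniversalEnvelopingAlgebra k L →ₐ[k] (UniversalEnvelopingAlgebra k L)ᵐᵒᵖ :=
  lift k (principalLie k L)

variable {L}

theorem principalHom_ι (x : L) : principalHom k L (ι k x) = MulOpposite.op (-(ι k x)) :=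
  lift_ι_apply k (principalLie k L) x

/-- The enveloping algebra is generated by `L`. -/
theorem adjoin_range_ι :
    Algebra.adjoin k (Set.range (ι k : L → UniversalEnvelopingAlgebra k L)) = ⊤ := by
  set S := Algebra.adjoin k (Set.range (ι k : L → UniversalEnvelopingAlgebra k L)) with hS
  let g : L →ₗ⁅k⁆ S :=
    { toFun := fun x => ⟨ι k x, Algebra.subset_adjoin ⟨x, rfl⟩⟩
      map_add' := fun x y => Subtype.ext (map_add (ι k) x y)
      map_smul' := fun c x => Subtype.ext (map_smul (ι k) c x)
      map_lie' := fun {x y} => Subtype.ext (LieHom.map_lie (ι k) x y) }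
  have h : S.val.comp (lift k g) = AlgHom.id k _ := by
    apply hom_ext
    ext x
    change ((lift k g (ι k x) : S) : UniversalEnvelopingAlgebra k L) = ι k x
    rw [lift_ι_apply]; rfl
  rw [eq_top_iff]
  intro x _
  have := DFunLike.congr_fun h x
  rw [AlgHom.id_apply] at this
  rw [← this]
  exact (lift k g x).2

theorem principalHom_invol (x : UniversalEnvelopingAlgebra k L) :
    (principalHom k L (principalHom k L x).unop).unop = x := by
  have hx : x ∈ Algebra.adjoin k (Set.range (ι k : L → UniversalEnvelopingAlgebra k L)) := by
    rw [adjoin_range_ι]; trivial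
  induction hx using Algebra.adjoin_induction with
  | mem y hy => 
    obtain ⟨z, rfl⟩ := hy
    rw [principalHom_ι, MulOpposite.unop_op, map_neg, principalHom_ι]
    simp
  | algebraMap r => simp [MulOpposite.algebraMap_apply]
  | add a b _ _ ha hb => simp [ha, hb]
  | mul a b _ _ ha hb => simp [ha, hb]

theorem principalHom_injective : Function.Injective (principalHom k L) := by
  intro x y h
  rw [← principalHom_invol k x, ← principalHom_invol k y, h]

end UniversalEnvelopingAlgebra

/-! ### The division ring of fractions of an enveloping algebra -/

/-- The Ore division ring of fractions `𝔇(L)` of the enveloping algebra `U(L)`, for a Lie algebra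
`L` whose enveloping algebra is an Ore domain. -/
abbrev LieFractions [IsOreDomain (UniversalEnvelopingAlgebra k L)] : Type _ :=
  OreLocalization (UniversalEnvelopingAlgebra k L)⁰ (UniversalEnvelopingAlgebra k L)

namespace LieFractions

variable [IsOreDomain (UniversalEnvelopingAlgebra k L)]

/-- The embedding of `U(L)` into `𝔇(L)`. -/
noncomputable def ofEnveloping : UniversalEnvelopingAlgebra k L →ₐ[k] LieFractions k L where
  __ := OreLocalization.numeratorRingHom
  commutes' _ := rfl

theorem ofEnveloping_injective : Function.Injective (ofEnveloping k L) :=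
  OreLocalization.numeratorHom_inj inf_le_left

/-- The canonical map of `L` into `𝔇(L)`. -/
noncomputable def ofLie : L →ₗ[k] LieFractions k L :=
  (ofEnveloping k L).toLinearMap ∘ₗ
    (UniversalEnvelopingAlgebra.ι k : L →ₗ⁅k⁆ UniversalEnvelopingAlgebra k L).toLinearMap

/-- Every element of `𝔇(L)` is a left fraction. -/
theorem exists_eq (x : LieFractions k L) : ∃ a s : UniversalEnvelopingAlgebra k L,
    s ≠ 0 ∧ x = (ofEnveloping k L s)⁻¹ * ofEnveloping k L a := by
  induction x using OreLocalization.ind with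
  | _ r s =>
    refine ⟨r, s, nonZeroDivisors.coe_ne_zero s, ?_⟩
    have hs : ofEnveloping k L s ≠ 0 := fun h => nonZeroDivisors.coe_ne_zero s
      (ofEnveloping_injective k L (h.trans (map_zero _).symm))
    apply mul_left_cancel₀ hs
    rw [mul_inv_cancel_left₀ hs]
    change (OreLocalization.numeratorHom (s : UniversalEnvelopingAlgebra k L) :
      LieFractions k L) * _ = OreLocalization.numeratorHom r
    rw [OreLocalization.numeratorHom_apply, OreLocalization.numeratorHom_apply,
      OreLocalization.mul_cancel]

section Lift

variable {k L} {D : Type*} [DivisionRing D]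

/-- The extension to `𝔇(L)` of an injective homomorphism from `U(L)` to a division ring. -/
noncomputable def liftHom (g : UniversalEnvelopingAlgebra k L →+* D)
    (hg : Function.Injective g) : LieFractions k L →+* D :=
  OreLocalization.universalHom g
    { toFun := fun s => Units.mk0 (g s)
        (fun h => nonZeroDivisors.coe_ne_zero s (hg (h.trans (map_zero g).symm)))
      map_one' := by ext; simp
      map_mul' := fun a b => by ext; simp }
    (fun _ => rfl)

theorem liftHom_ofEnveloping (g : UniversalEnvelopingAlgebra k L →+* D)
    (hg : Function.Injective g) (x : UniversalEnvelopingAlgebra k L) :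
    liftHom g hg (ofEnveloping k L x) = g x :=
  OreLocalization.universalHom_commutes _ _ _

end Lift

/-- Any division algebra that contains `U(L)` and is generated by it as a division ring is
isomorphic to `𝔇(L)` over `U(L)`. -/
theorem exists_algEquiv {D : Type*} [DivisionRing D] [Algebra k D]
    (g : UniversalEnvelopingAlgebra k L →ₐ[k] D) (hg : Function.Injective g)
    (hgen : ∀ S : Subring D, (∀ x ∈ S, x⁻¹ ∈ S) → Set.range g ⊆ S → S = ⊤) :
    ∃ φ : LieFractions k L ≃ₐ[k] D, ∀ x, φ (ofEnveloping k L x) = g x := by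
  let φ₀ : LieFractions k L →+* D := liftHom g.toRingHom hg
  have h₀ : ∀ x, φ₀ (ofEnveloping k L x) = g x := liftHom_ofEnveloping g.toRingHom hg
  let φ : LieFractions k L →ₐ[k] D :=
    { φ₀ with
      commutes' := fun c => by
        have := h₀ (algebraMap k _ c)
        rw [AlgHom.commutes, AlgHom.commutes] at this
        exact this }
  have hrange : φ₀.range = ⊤ := by
    apply hgen
    · rintro _ ⟨y, rfl⟩
      exact ⟨y⁻¹, map_inv₀ φ₀ y⟩
    · rintro _ ⟨x, rfl⟩
      exact ⟨_, h₀ x⟩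
  refine ⟨AlgEquiv.ofBijective φ ⟨φ₀.injective, fun y => ?_⟩, h₀⟩
  have hy : y ∈ φ₀.range := by rw [hrange]; trivial
  exact hy

/-- The embedding of `U(L)` into the opposite of `𝔇(L)` given by the principal involution. -/
noncomputable def principalEmb :
    UniversalEnvelopingAlgebra k L →+* (LieFractions k L)ᵐᵒᵖ :=
  (ofEnveloping k L).toRingHom.op.comp (UniversalEnvelopingAlgebra.principalHom k L).toRingHom

theorem principalEmb_injective : Function.Injective (principalEmb k L) := by
  intro x y h
  apply UniversalEnvelopingAlgebra.principalHom_injective k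
  apply MulOpposite.unop_injective
  apply ofEnveloping_injective k L
  exact congrArg MulOpposite.unop h

/-- The principal involution of `𝔇(L)`: the extension to `𝔇(L)` of `x ↦ -x` on `L`. -/
noncomputable def principalInvolution : LieFractions k L →ₗ[k] LieFractions k L where
  toFun x := (liftHom (principalEmb k L) (principalEmb_injective k L) x).unop
  map_add' x y := by simp
  map_smul' c x := by
    rw [Algebra.smul_def, map_mul, MulOpposite.unop_mul, RingHom.id_apply, Algebra.smul_def,
      Algebra.commutes c]
    congr 1
    rw [← (ofEnveloping k L).commutes c, liftHom_ofEnveloping]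
    simp [principalEmb, MulOpposite.algebraMap_apply]

theorem principalInvolution_ofEnveloping (x : UniversalEnvelopingAlgebra k L) :
    principalInvolution k L (ofEnveloping k L x) =
      ofEnveloping k L (UniversalEnvelopingAlgebra.principalHom k L x).unop :=
  congrArg MulOpposite.unop (liftHom_ofEnveloping _ (principalEmb_injective k L) x)

theorem principalInvolution_ofLie (x : L) :
    principalInvolution k L (ofLie k L x) = -ofLie k L x := by
  have h := principalInvolution_ofEnveloping k L (UniversalEnvelopingAlgebra.ι k x)
  rw [UniversalEnvelopingAlgebra.principalHom_ι, MulOpposite.unop_op, map_neg] at h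
  exact h

theorem principalInvolution_mul (x y : LieFractions k L) :
    principalInvolution k L (x * y) =
      principalInvolution k L y * principalInvolution k L x := by
  change (liftHom (principalEmb k L) (principalEmb_injective k L) (x * y)).unop = _
  rw [map_mul]
  rfl

theorem principalInvolution_inv (x : LieFractions k L) :
    principalInvolution k L x⁻¹ = (principalInvolution k L x)⁻¹ := by
  change (liftHom (principalEmb k L) (principalEmb_injective k L) x⁻¹).unop = _
  rw [map_inv₀]
  rfl

theorem principalInvolution_invol (x : LieFractions k L) :
    principalInvolution k L (principalInvolution k L x) = x := by
  obtain ⟨a, s, -, rfl⟩ := exists_eq k L x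
  simp only [principalInvolution_mul, principalInvolution_inv, principalInvolution_ofEnveloping,
    UniversalEnvelopingAlgebra.principalHom_invol]

end LieFractions

end Enveloping

/-! ### The noncommutative two-dimensional Lie algebra -/

/-- `M` is a noncommutative Lie algebra of dimension two over `k`. -/
class IsNoncommPlane (k : Type*) [Field k] (M : Type*) [LieRing M] [LieAlgebra k M] : Prop where
  finrank_eq : Module.finrank k M = 2
  not_abelian : ¬ IsLieAbelian M

namespace IsNoncommPlane

attribute [local instance 100] LieRing.ofAssociativeRing

open Polynomial

section

variable (k : Type*) [Field k] (M : Type*) [LieRing M] [LieAlgebra k M]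

theorem exists_basis [IsNoncommPlane k M] :
    ∃ b : Module.Basis (Fin 2) k M, ⁅b 0, b 1⁆ = b 1 := by
  have : FiniteDimensional k M := Module.finite_of_finrank_pos (by
    rw [IsNoncommPlane.finrank_eq]; norm_num)
  let c := Module.finBasisOfFinrankEq k M (IsNoncommPlane.finrank_eq (k := k) (M := M))
  set g := ⁅c 0, c 1⁆ with hg
  have key : ∀ x y : M, ⁅x, y⁆ = (c.repr x 0 * c.repr y 1 - c.repr x 1 * c.repr y 0) • g := by
    intro x y
    conv_lhs => rw [← c.sum_repr x, ← c.sum_repr y]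
    simp only [Fin.sum_univ_two, add_lie, lie_add, smul_lie, lie_smul, lie_self, smul_zero,
      zero_add, add_zero]
    rw [← lie_skew (c 1) (c 0), ← hg]
    module
  have hg0 : g ≠ 0 := by
    intro h
    apply IsNoncommPlane.not_abelian (k := k) (M := M)
    refine ⟨fun x y => ?_⟩
    rw [key x y, h, smul_zero]
  have hx : ∃ x : M, ⁅x, g⁆ = g := by
    by_cases h1 : c.repr g 1 = 0
    · have h0 : c.repr g 0 ≠ 0 := by
        intro h0
        apply hg0
        rw [← c.sum_repr g, Fin.sum_univ_two, h0, h1]; simp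
      refine ⟨(-(c.repr g 0)⁻¹) • c 1, ?_⟩
      rw [key]
      simp [h0]
    · refine ⟨(c.repr g 1)⁻¹ • c 0, ?_⟩
      rw [key]
      simp [h1]
  obtain ⟨x, hx⟩ := hx
  have hli : LinearIndependent k ![x, g] := by
    rw [LinearIndependent.pair_iff]
    intro s t hst
    have h1 : s • g = 0 := by
      have h2 : ⁅s • x + t • g, g⁆ = 0 := by rw [hst, zero_lie]
      rwa [add_lie, smul_lie, smul_lie, lie_self, smul_zero, add_zero, hx] at h2
    have hs : s = 0 := (smul_eq_zero.1 h1).resolve_right hg0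
    rw [hs, zero_smul, zero_add] at hst
    exact ⟨hs, (smul_eq_zero.1 hst).resolve_right hg0⟩
  refine ⟨basisOfLinearIndependentOfCardEqFinrank hli (by
    rw [IsNoncommPlane.finrank_eq, Fintype.card_fin]), ?_⟩
  simp [hx]

end

section

variable {k : Type*} [Field k]

/-- The substitution `x ↦ x - 1` in the coefficients of a polynomial in `y` over `k[x]`. -/
noncomputable def shift : k[X][X] →+* k[X][X] :=
  Polynomial.mapRingHom (Polynomial.compRingHom (X - C 1))

theorem shift_C_X : shift (C (X : k[X])) = C (X - C 1) := by simp [shift]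

theorem shift_iterate_coeff (n : ℕ) (Q : k[X][X]) (m : ℕ) :
    (shift^[n] Q).coeff m = (fun p : k[X] => p.comp (X - C 1))^[n] (Q.coeff m) := by
  induction n generalizing Q with
  | zero => rfl
  | succ n ih => 
    rw [Function.iterate_succ_apply, ih, Function.iterate_succ_apply]
    simp [shift]

theorem natDegree_iterate_comp (n : ℕ) (p : k[X]) :
    ((fun p : k[X] => p.comp (X - C 1))^[n] p).natDegree = p.natDegree := by
  induction n generalizing p with
  | zero => rfl
  | succ n ih => rw [Function.iterate_succ_apply, ih, natDegree_comp, natDegree_X_sub_C, mul_one]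

theorem iterate_comp_ne_zero (n : ℕ) {p : k[X]} (hp : p ≠ 0) :
    (fun p : k[X] => p.comp (X - C 1))^[n] p ≠ 0 := by
  induction n generalizing p with
  | zero => exact hp
  | succ n ih => 
    rw [Function.iterate_succ_apply]
    apply ih
    intro h
    rcases comp_eq_zero_iff.1 h with h | ⟨-, h⟩
    · exact hp h
    · have := congrArg natDegree h
      rw [natDegree_X_sub_C, natDegree_C] at this
      exact one_ne_zero this

/-- The product of the enveloping algebra in the coordinates `∑ pᵢ(e) fⁱ`. -/
noncomputable def starMul (P Q : k[X][X]) : k[X][X] :=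
  P.sum fun i p => C p * (X ^ i * shift^[i] Q)

theorem starMul_coeff (P Q : k[X][X]) (m : ℕ) :
    (starMul P Q).coeff m = ∑ i ∈ P.support, if i ≤ m then
      P.coeff i * (fun p : k[X] => p.comp (X - C 1))^[i] (Q.coeff (m - i)) else 0 := by
  rw [starMul, Polynomial.sum_def, finsetSum_coeff]
  refine Finset.sum_congr rfl fun i _ => ?_
  rw [coeff_C_mul, coeff_X_pow_mul', mul_ite, mul_zero, shift_iterate_coeff]

theorem starMul_ne_zero {P Q : k[X][X]} (hP : P ≠ 0) (hQ : Q ≠ 0) : starMul P Q ≠ 0 := by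
  intro h
  have h1 := congrArg (fun R => coeff R (P.natDegree + Q.natDegree)) h
  simp only [starMul_coeff, coeff_zero] at h1
  rw [Finset.sum_eq_single P.natDegree] at h1
  · rw [if_pos (Nat.le_add_right _ _), Nat.add_sub_cancel_left] at h1
    rcases mul_eq_zero.1 h1 with h2 | h2
    · exact hP (leadingCoeff_eq_zero.1 h2)
    · exact iterate_comp_ne_zero _ (mt leadingCoeff_eq_zero.1 hQ) h2
  · intro i hi hne
    have hlt : i < P.natDegree := lt_of_le_of_ne (le_natDegree_of_mem_supp i hi) hne
    rw [if_pos (by omega), coeff_eq_zero_of_natDegree_lt (by omega : Q.natDegree < _)]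
    have : ∀ n : ℕ, (fun p : k[X] => p.comp (X - C 1))^[n] 0 = 0 := by
      intro n
      induction n with
      | zero => rfl
      | succ n ih => rw [Function.iterate_succ_apply, zero_comp, ih]
    rw [this, mul_zero]
  · intro h2
    exact absurd (natDegree_mem_support_of_nonzero hP) h2

theorem starMul_natDegree_le (P Q : k[X][X]) :
    (starMul P Q).natDegree ≤ P.natDegree + Q.natDegree := by
  rw [natDegree_le_iff_coeff_eq_zero]
  intro m hm
  rw [starMul_coeff]
  refine Finset.sum_eq_zero fun i hi => ?_
  have := le_natDegree_of_mem_supp i hi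
  split_ifs with him
  · rw [← shift_iterate_coeff]
    rw [shift_iterate_coeff, coeff_eq_zero_of_natDegree_lt (by omega : Q.natDegree < m - i)]
    have h0 : (fun p : k[X] => p.comp (X - C 1))^[i] 0 = 0 :=
      Function.iterate_fixed (f := fun p : k[X] => p.comp (X - C 1)) zero_comp i
    rw [h0, mul_zero]
  · rfl

theorem starMul_coeff_natDegree_le (P Q : k[X][X]) (a b : ℕ)
    (hP : ∀ i, (P.coeff i).natDegree ≤ a) (hQ : ∀ i, (Q.coeff i).natDegree ≤ b) (m : ℕ) :
    ((starMul P Q).coeff m).natDegree ≤ a + b := by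
  rw [starMul_coeff]
  refine natDegree_sum_le_of_forall_le _ _ fun i _ => ?_
  split_ifs with h
  · refine natDegree_mul_le.trans (add_le_add (hP i) ?_)
    rw [natDegree_iterate_comp]
    exact hQ _
  · simp

/-- The operator by which `e` acts on `k[x][y]`. -/
noncomputable def opE : Module.End k k[X][X] := LinearMap.mulLeft k (C (X : k[X]))

theorem shift_smul (c : k) (Q : k[X][X]) : shift (c • Q) = c • shift Q := by
  ext i : 1
  simp [shift, smul_comp]

/-- The operator by which `f` acts on `k[x][y]`. -/
noncomputable def opF : Module.End k k[X][X] where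
  toFun Q := X * shift Q
  map_add' P Q := by rw [map_add, mul_add]
  map_smul' c Q := by rw [shift_smul, mul_smul_comm, RingHom.id_apply]

theorem opE_apply (Q : k[X][X]) : opE Q = C (X : k[X]) * Q := rfl

theorem opF_apply (Q : k[X][X]) : opF Q = X * shift Q := rfl

theorem op_lie : (opE : Module.End k k[X][X]) * opF - opF * opE = opF := by
  ext1 Q
  simp only [LinearMap.sub_apply, Module.End.mul_apply, opE_apply, opF_apply, map_mul, shift_C_X,
    C_sub, C_1]
  ring

end

section

variable {k : Type*} [Field k] {M : Type*} [LieRing M] [LieAlgebra k M]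
  (b : Module.Basis (Fin 2) k M) (hb : ⁅b 0, b 1⁆ = b 1)

/-- The action of `M` on `k[x][y]`. -/
noncomputable def action : M →ₗ⁅k⁆ Module.End k k[X][X] where
  __ := b.constr k ![opE, opF]
  map_lie' {x y} := by
    have h0 : b.constr k ![(opE : Module.End k k[X][X]), opF] (b 0) = opE := by
      rw [Module.Basis.constr_basis]; rfl
    have h1 : b.constr k ![(opE : Module.End k k[X][X]), opF] (b 1) = opF := by
      rw [Module.Basis.constr_basis]; rfl
    change b.constr k ![opE, opF] ⁅x, y⁆ =
      ⁅b.constr k ![(opE : Module.End k k[X][X]), opF] x, b.constr k ![opE, opF] y⁆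
    have hb' : ⁅b 1, b 0⁆ = -b 1 := by rw [← lie_skew, hb]
    have key : ∀ a c a' c' : k, (a • opE + c • opF) * (a' • opE + c' • opF) -
        (a' • opE + c' • opF) * (a • opE + c • opF) =
          (a * c' - c * a') • (opF : Module.End k k[X][X]) := by
      intro a c a' c'
      conv_rhs => rw [← op_lie]
      simp only [add_mul, mul_add, smul_mul_assoc, mul_smul_comm]
      module
    rw [← b.sum_repr x, ← b.sum_repr y]
    simp only [Fin.sum_univ_two, add_lie, lie_add, smul_lie, lie_smul, lie_self, smul_zero,
      map_add, map_smul, h0, h1, map_zero, hb, hb', LieRing.of_associative_ring_bracket, key,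
      map_neg]
    module

/-- The action of the enveloping algebra on `k[x][y]`. -/
noncomputable def actionU : UniversalEnvelopingAlgebra k M →ₐ[k] Module.End k k[X][X] :=
  UniversalEnvelopingAlgebra.lift k (action b hb)

theorem actionU_e : actionU b hb (UniversalEnvelopingAlgebra.ι k (b 0)) = opE := by
  rw [actionU, UniversalEnvelopingAlgebra.lift_ι_apply]
  change b.constr k ![(opE : Module.End k k[X][X]), opF] (b 0) = opE
  rw [Module.Basis.constr_basis]; rfl

theorem actionU_f : actionU b hb (UniversalEnvelopingAlgebra.ι k (b 1)) = opF := by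
  rw [actionU, UniversalEnvelopingAlgebra.lift_ι_apply]
  change b.constr k ![(opE : Module.End k k[X][X]), opF] (b 1) = opF
  rw [Module.Basis.constr_basis]; rfl

/-- The element `∑ pᵢ(e) fⁱ` of the enveloping algebra. -/
noncomputable def normalForm : k[X][X] →ₗ[k] UniversalEnvelopingAlgebra k M where
  toFun P := P.sum fun i p => aeval (UniversalEnvelopingAlgebra.ι k (b 0)) p * (UniversalEnvelopingAlgebra.ι k (b 1)) ^ i
  map_add' P Q := Polynomial.sum_add_index P Q _ (by simp) (by intros; simp [add_mul])
  map_smul' c P := by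
    rw [RingHom.id_apply, Polynomial.sum_def, Polynomial.sum_def, Finset.smul_sum]
    rw [Finset.sum_subset (support_smul c P)]
    · refine Finset.sum_congr rfl fun i _ => ?_
      rw [coeff_smul, map_smul, smul_mul_assoc]
    · intro i _ hi
      rw [notMem_support_iff.1 hi]; simp

theorem normalForm_monomial (i : ℕ) (p : k[X]) :
    normalForm b (C p * X ^ i) = aeval (UniversalEnvelopingAlgebra.ι k (b 0)) p * (UniversalEnvelopingAlgebra.ι k (b 1)) ^ i := by
  change (C p * X ^ i : k[X][X]).sum (fun i p => aeval (UniversalEnvelopingAlgebra.ι k (b 0)) p *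
    (UniversalEnvelopingAlgebra.ι k (b 1)) ^ i) = _
  rw [C_mul_X_pow_eq_monomial, sum_monomial_index]
  simp

theorem actionU_aeval (p : k[X]) (Q : k[X][X]) : actionU b hb (aeval (UniversalEnvelopingAlgebra.ι k (b 0)) p) Q = C p * Q := by
  induction p using Polynomial.induction_on' with
  | add p q hp hq => simp only [map_add, LinearMap.add_apply, hp, hq, add_mul]
  | monomial n c =>
    rw [aeval_monomial, map_mul, map_pow, actionU_e, AlgHom.commutes, Module.End.mul_apply,
      Module.algebraMap_end_apply]
    have : ∀ n : ℕ, ((opE : Module.End k k[X][X]) ^ n) Q = C (X ^ n) * Q := by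
      intro n
      induction n with
      | zero => simp
      | succ n ih => rw [pow_succ', Module.End.mul_apply, ih, opE_apply, pow_succ', C_mul, mul_assoc]
    rw [this, ← C_mul_X_pow_eq_monomial, C_mul, mul_assoc, Algebra.smul_def]
    rfl

theorem actionU_pow (i : ℕ) (Q : k[X][X]) :
    actionU b hb ((UniversalEnvelopingAlgebra.ι k (b 1)) ^ i) Q = X ^ i * shift^[i] Q := by
  rw [map_pow, actionU_f]
  induction i with
  | zero => simp
  | succ n ih =>
    rw [pow_succ', Module.End.mul_apply, ih, opF_apply, map_mul, map_pow,
      Function.iterate_succ_apply']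
    have : shift (X : k[X][X]) = X := by simp [shift]
    rw [this, pow_succ', mul_assoc]

theorem actionU_normalForm (P Q : k[X][X]) :
    actionU b hb (normalForm b P) Q = starMul P Q := by
  change actionU b hb (P.sum fun i p => aeval (UniversalEnvelopingAlgebra.ι k (b 0)) p *
    (UniversalEnvelopingAlgebra.ι k (b 1)) ^ i) Q = _
  rw [starMul, Polynomial.sum_def, Polynomial.sum_def, map_sum, LinearMap.sum_apply]
  refine Finset.sum_congr rfl fun i _ => ?_
  rw [map_mul, Module.End.mul_apply, actionU_pow, actionU_aeval]

theorem starMul_one (P : k[X][X]) : starMul P 1 = P := by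
  conv_rhs => rw [P.as_sum_support_C_mul_X_pow]
  rw [starMul, Polynomial.sum_def]
  refine Finset.sum_congr rfl fun i _ => ?_
  have : shift^[i] (1 : k[X][X]) = 1 := Function.iterate_fixed (map_one _) i
  rw [this, mul_one]

theorem normalForm_injective (b : Module.Basis (Fin 2) k M) (hb : ⁅b 0, b 1⁆ = b 1) :
    Function.Injective (normalForm b) := by
  intro P Q h
  rw [← starMul_one P, ← starMul_one Q, ← actionU_normalForm b hb, ← actionU_normalForm b hb, h]

theorem f_mul_aeval (b : Module.Basis (Fin 2) k M) (hb : ⁅b 0, b 1⁆ = b 1) (p : k[X]) :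
    (UniversalEnvelopingAlgebra.ι k (b 1)) * aeval (UniversalEnvelopingAlgebra.ι k (b 0)) p = aeval (UniversalEnvelopingAlgebra.ι k (b 0)) (p.comp (X - C 1)) * (UniversalEnvelopingAlgebra.ι k (b 1)) := by
  have h : (UniversalEnvelopingAlgebra.ι k (b 1)) * (UniversalEnvelopingAlgebra.ι k (b 0)) = ((UniversalEnvelopingAlgebra.ι k (b 0)) - 1) * (UniversalEnvelopingAlgebra.ι k (b 1)) := by
    have h1 := (UniversalEnvelopingAlgebra.ι k).map_lie (b 0) (b 1)
    rw [hb, LieRing.of_associative_ring_bracket] at h1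
    rw [sub_mul, one_mul]
    exact (sub_eq_of_eq_add (sub_eq_iff_eq_add'.1 h1.symm)).symm
  induction p using Polynomial.induction_on with
  | C a => rw [C_comp, aeval_C, Algebra.commutes]
  | add p q hp hq => rw [map_add, mul_add, hp, hq, add_comp, map_add, add_mul]
  | monomial n a ih =>
    rw [pow_succ, ← mul_assoc, map_mul, aeval_X, ← mul_assoc, ih, mul_comp (C a * X ^ n), map_mul,
      X_comp, map_sub, aeval_X, aeval_C, mul_assoc, h, mul_assoc]
    simp only [map_one]

theorem ι_mul_normalForm (b : Module.Basis (Fin 2) k M) (hb : ⁅b 0, b 1⁆ = b 1) (x : M)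
    (Q : k[X][X]) : UniversalEnvelopingAlgebra.ι k x * normalForm b Q =
      normalForm b (actionU b hb (UniversalEnvelopingAlgebra.ι k x) Q) := by
  have he : ∀ Q : k[X][X], (UniversalEnvelopingAlgebra.ι k (b 0)) * normalForm b Q = normalForm b (opE Q) := by
    intro Q
    induction Q using Polynomial.induction_on' with
    | add p q hp hq => rw [map_add, map_add, mul_add, hp, hq, map_add]
    | monomial n p =>
      rw [opE_apply, ← C_mul_X_pow_eq_monomial, ← mul_assoc, ← C_mul, normalForm_monomial,
        normalForm_monomial, map_mul, aeval_X, mul_assoc]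
  have hf : ∀ Q : k[X][X], (UniversalEnvelopingAlgebra.ι k (b 1)) * normalForm b Q = normalForm b (opF Q) := by
    intro Q
    induction Q using Polynomial.induction_on' with
    | add p q hp hq => rw [map_add, map_add, mul_add, hp, hq, map_add]
    | monomial n p =>
      have h : opF (C p * X ^ n : k[X][X]) = C (p.comp (X - C 1)) * X ^ (n + 1) := by
        rw [opF_apply, map_mul, map_pow]
        have h1 : shift (X : k[X][X]) = X := by simp [shift]
        have h2 : shift (C p) = C (p.comp (X - C 1)) := by simp [shift]
        rw [h1, h2]; ring
      rw [← C_mul_X_pow_eq_monomial, h, normalForm_monomial, normalForm_monomial, ← mul_assoc,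
        f_mul_aeval b hb, pow_succ', mul_assoc]
  rw [← b.sum_repr x, Fin.sum_univ_two]
  simp only [map_add, map_smul, add_mul, smul_mul_assoc, he, hf, actionU_e, actionU_f,
    LinearMap.add_apply, LinearMap.smul_apply]

theorem mul_normalForm (b : Module.Basis (Fin 2) k M) (hb : ⁅b 0, b 1⁆ = b 1)
    (u : UniversalEnvelopingAlgebra k M) (Q : k[X][X]) :
    u * normalForm b Q = normalForm b (actionU b hb u Q) := by
  have hu : u ∈ Algebra.adjoin k
      (Set.range (UniversalEnvelopingAlgebra.ι k : M → UniversalEnvelopingAlgebra k M)) := by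
    rw [UniversalEnvelopingAlgebra.adjoin_range_ι]; trivial
  induction hu using Algebra.adjoin_induction generalizing Q with
  | mem y hy =>
    obtain ⟨x, rfl⟩ := hy
    exact ι_mul_normalForm b hb x Q
  | algebraMap r =>
    rw [AlgHom.commutes, Module.algebraMap_end_apply, map_smul, Algebra.smul_def]
  | add x y _ _ hx hy => rw [add_mul, hx, hy, map_add, LinearMap.add_apply, map_add]
  | mul x y _ _ hx hy => rw [mul_assoc, hy, hx, map_mul, Module.End.mul_apply]

theorem normalForm_mul (b : Module.Basis (Fin 2) k M) (hb : ⁅b 0, b 1⁆ = b 1) (P Q : k[X][X]) :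
    normalForm b P * normalForm b Q = normalForm b (starMul P Q) := by
  rw [mul_normalForm b hb, actionU_normalForm]

theorem normalForm_one (b : Module.Basis (Fin 2) k M) : normalForm b 1 = 1 := by
  have h := normalForm_monomial b 0 1
  simpa using h

theorem normalForm_surjective (b : Module.Basis (Fin 2) k M) (hb : ⁅b 0, b 1⁆ = b 1) :
    Function.Surjective (normalForm b) := by
  intro u
  refine ⟨actionU b hb u 1, ?_⟩
  rw [← mul_normalForm b hb, normalForm_one, mul_one]

theorem noZeroDivisors_of_basis (b : Module.Basis (Fin 2) k M) (hb : ⁅b 0, b 1⁆ = b 1) :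
    NoZeroDivisors (UniversalEnvelopingAlgebra k M) where
  eq_zero_or_eq_zero_of_mul_eq_zero {u v} h := by
    obtain ⟨P, rfl⟩ := normalForm_surjective b hb u
    obtain ⟨Q, rfl⟩ := normalForm_surjective b hb v
    rw [normalForm_mul b hb] at h
    by_contra! hne
    refine starMul_ne_zero (P := P) (Q := Q) ?_ ?_ (normalForm_injective b hb (h.trans (map_zero _).symm))
    · rintro rfl; exact hne.1 (map_zero _)
    · rintro rfl; exact hne.2 (map_zero _)

end

section

variable {k : Type*} [Field k]

/-- The polynomial of bidegree at most `(n, n)` with given coefficients. -/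
noncomputable def ofCoeffs (n : ℕ) : (Fin (n + 1) × Fin (n + 1) → k) →ₗ[k] k[X][X] where
  toFun c := ∑ j, ∑ i, C (C (c (i, j)) * X ^ (i : ℕ)) * X ^ (j : ℕ)
  map_add' c d := by
    simp only [Pi.add_apply, map_add, add_mul, Finset.sum_add_distrib]
  map_smul' r c := by
    rw [RingHom.id_apply, Finset.smul_sum]
    refine Finset.sum_congr rfl fun j _ => ?_
    rw [Finset.smul_sum]
    refine Finset.sum_congr rfl fun i _ => ?_
    rw [← smul_mul_assoc, smul_C, ← smul_mul_assoc, smul_C, Pi.smul_apply]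

theorem ofCoeffs_coeff (n : ℕ) (c : Fin (n + 1) × Fin (n + 1) → k) (m : ℕ) :
    (ofCoeffs n c).coeff m = ∑ j : Fin (n + 1), ∑ i : Fin (n + 1),
      if m = (j : ℕ) then C (c (i, j)) * X ^ (i : ℕ) else 0 := by
  change (∑ j : Fin (n + 1), ∑ i : Fin (n + 1),
    C (C (c (i, j)) * X ^ (i : ℕ)) * X ^ (j : ℕ) : k[X][X]).coeff m = _
  simp only [finsetSum_coeff, coeff_C_mul_X_pow]

theorem ofCoeffs_natDegree_le (n : ℕ) (c : Fin (n + 1) × Fin (n + 1) → k) :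
    (ofCoeffs n c).natDegree ≤ n := by
  rw [natDegree_le_iff_coeff_eq_zero]
  intro m hm
  rw [ofCoeffs_coeff]
  refine Finset.sum_eq_zero fun j _ => Finset.sum_eq_zero fun i _ => if_neg ?_
  have := j.2
  omega

theorem ofCoeffs_coeff_natDegree_le (n : ℕ) (c : Fin (n + 1) × Fin (n + 1) → k) (m : ℕ) :
    ((ofCoeffs n c).coeff m).natDegree ≤ n := by
  rw [ofCoeffs_coeff]
  refine natDegree_sum_le_of_forall_le _ _ fun j _ => natDegree_sum_le_of_forall_le _ _ fun i _ => ?_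
  split_ifs
  · exact (natDegree_C_mul_X_pow_le _ _).trans (Nat.lt_succ_iff.1 i.2)
  · simp

theorem ofCoeffs_injective (n : ℕ) : Function.Injective (ofCoeffs (k := k) n) := by
  rw [injective_iff_map_eq_zero]
  intro c hc
  ext ⟨i, j⟩
  have h := congrArg (fun P => (coeff P (j : ℕ)).coeff (i : ℕ)) hc
  simp only [ofCoeffs_coeff, finsetSum_coeff, coeff_zero] at h
  rw [Finset.sum_eq_single j, Finset.sum_eq_single i] at h
  · simpa using h
  · intro i' _ hne
    rw [if_pos rfl, coeff_C_mul_X_pow, if_neg]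
    exact fun h' => hne (Fin.ext h'.symm)
  · simp
  · intro j' _ hne
    refine Finset.sum_eq_zero fun i' _ => ?_
    rw [if_neg, coeff_zero]
    exact fun h' => hne (Fin.ext h'.symm)
  · simp

/-- Reading off coefficients. -/
noncomputable def toCoeffs (n : ℕ) : k[X][X] →ₗ[k] (Fin (n + 1) × Fin (n + 1) → k) where
  toFun P a := (P.coeff a.2).coeff a.1
  map_add' P Q := by ext; simp
  map_smul' c P := by ext; simp

theorem eq_zero_of_toCoeffs {n : ℕ} {P : k[X][X]} (h1 : P.natDegree ≤ n)
    (h2 : ∀ m, (P.coeff m).natDegree ≤ n) (h : toCoeffs n P = 0) : P = 0 := by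
  ext m i
  rw [coeff_zero, coeff_zero]
  by_cases hm : m ≤ n
  · by_cases hi : i ≤ n
    · exact congrFun h (⟨i, by omega⟩, ⟨m, by omega⟩)
    · exact coeff_eq_zero_of_natDegree_lt ((h2 m).trans_lt (by omega))
  · rw [coeff_eq_zero_of_natDegree_lt (h1.trans_lt (by omega)), coeff_zero]

theorem exists_bound (P : k[X][X]) : ∃ n, P.natDegree ≤ n ∧ ∀ m, (P.coeff m).natDegree ≤ n := by
  refine ⟨P.natDegree + P.support.sup fun m => (P.coeff m).natDegree, by omega, fun m => ?_⟩
  by_cases hm : m ∈ P.support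
  · exact (Finset.le_sup (f := fun m => (P.coeff m).natDegree) hm).trans (by omega)
  · rw [notMem_support_iff.1 hm]; simp

/-- Right multiplication in the coordinates `∑ pᵢ(e) fⁱ`. -/
noncomputable def starRight (Q : k[X][X]) : k[X][X] →ₗ[k] k[X][X] where
  toFun P := starMul P Q
  map_add' P P' := Polynomial.sum_add_index P P' _ (by simp) (by intros; simp [add_mul])
  map_smul' c P := by
    rw [RingHom.id_apply, starMul, starMul, Polynomial.sum_def, Polynomial.sum_def,
      Finset.smul_sum]
    rw [Finset.sum_subset (support_smul c P)]
    · refine Finset.sum_congr rfl fun i _ => ?_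
      rw [coeff_smul, ← smul_C, smul_mul_assoc]
    · intro i _ hi
      rw [notMem_support_iff.1 hi]; simp

theorem exists_starMul_eq (R S : k[X][X]) (hS : S ≠ 0) :
    ∃ A B : k[X][X], A ≠ 0 ∧ starMul A R = starMul B S := by
  obtain ⟨r, hr1, hr2⟩ := exists_bound R
  obtain ⟨s, hs1, hs2⟩ := exists_bound S
  let d := r + s
  let n := 3 * (d + 1)
  let V := Fin (n + 1) × Fin (n + 1) → k
  let φ : V × V →ₗ[k] (Fin (n + d + 1) × Fin (n + d + 1) → k) :=
    toCoeffs (n + d) ∘ₗ ((starRight R ∘ₗ ofCoeffs n).coprod (-(starRight S ∘ₗ ofCoeffs n)))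
  have hlt : Module.finrank k (Fin (n + d + 1) × Fin (n + d + 1) → k) <
      Module.finrank k (V × V) := by
    rw [Module.finrank_prod, Module.finrank_fintype_fun_eq_card,
      Module.finrank_fintype_fun_eq_card, Fintype.card_prod, Fintype.card_prod, Fintype.card_fin,
      Fintype.card_fin]
    simp only [n]
    nlinarith
  have hker := LinearMap.ker_ne_bot_of_finrank_lt (f := φ) hlt
  obtain ⟨⟨c, c'⟩, hc, hne⟩ := (Submodule.ne_bot_iff _).1 hker
  have hsub : starMul (ofCoeffs n c) R - starMul (ofCoeffs n c') S = 0 := by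
    apply eq_zero_of_toCoeffs (n := n + d)
    · refine (natDegree_sub_le _ _).trans (max_le ?_ ?_)
      · refine (starMul_natDegree_le _ _).trans (add_le_add (ofCoeffs_natDegree_le n c) ?_)
        omega
      · refine (starMul_natDegree_le _ _).trans (add_le_add (ofCoeffs_natDegree_le n c') ?_)
        omega
    · intro m
      rw [coeff_sub]
      refine (natDegree_sub_le _ _).trans (max_le ?_ ?_)
      · exact starMul_coeff_natDegree_le _ _ n d (ofCoeffs_coeff_natDegree_le n c)
          (fun i => (hr2 i).trans (by omega)) m
      · exact starMul_coeff_natDegree_le _ _ n d (ofCoeffs_coeff_natDegree_le n c')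
          (fun i => (hs2 i).trans (by omega)) m
    · have h := LinearMap.mem_ker.1 hc
      simp only [φ, LinearMap.comp_apply, LinearMap.coprod_apply, LinearMap.neg_apply] at h
      rw [← sub_eq_add_neg] at h
      exact h
  refine ⟨ofCoeffs n c, ofCoeffs n c', fun h0 => hne ?_, sub_eq_zero.1 hsub⟩
  have hc0 : c = 0 := ofCoeffs_injective n (h0.trans (map_zero _).symm)
  have hc0' : c' = 0 := by
    by_contra hne'
    refine starMul_ne_zero (P := ofCoeffs n c') (Q := S) (fun h => hne' ?_) hS ?_
    · exact ofCoeffs_injective n (h.trans (map_zero _).symm)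
    · rw [← sub_eq_zero.1 hsub, h0, starMul, Polynomial.sum_zero_index]
  rw [hc0, hc0']; rfl

end

/-- The enveloping algebra of the noncommutative two-dimensional Lie algebra is an Ore domain. -/
instance isOreDomain (k : Type*) [Field k] (M : Type*) [LieRing M] [LieAlgebra k M]
    [IsNoncommPlane k M] : IsOreDomain (UniversalEnvelopingAlgebra k M) := by
  obtain ⟨b, hb⟩ := IsNoncommPlane.exists_basis k M
  have hnt : Nontrivial (UniversalEnvelopingAlgebra k M) :=
    (normalForm_injective b hb).nontrivial
  have hnz : NoZeroDivisors (UniversalEnvelopingAlgebra k M) := noZeroDivisors_of_basis b hb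
  have hleft : ∀ a s : UniversalEnvelopingAlgebra k M, s ≠ 0 →
      ∃ a' s' : UniversalEnvelopingAlgebra k M, s' ≠ 0 ∧ s' * a = a' * s := by
    intro a s hs
    by_cases ha : a = 0
    · exact ⟨0, 1, one_ne_zero, by rw [ha]; simp⟩
    obtain ⟨R, rfl⟩ := normalForm_surjective b hb a
    obtain ⟨S, rfl⟩ := normalForm_surjective b hb s
    obtain ⟨A, B, hA, h⟩ := exists_starMul_eq R S
      (fun h => hs (by rw [h, map_zero]))
    refine ⟨normalForm b B, normalForm b A,
      fun h0 => hA (normalForm_injective b hb (h0.trans (map_zero _).symm)), ?_⟩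
    rw [normalForm_mul b hb, normalForm_mul b hb, h]
  refine ⟨hnt, hnz, hleft, fun a s hs => ?_⟩
  let τ := UniversalEnvelopingAlgebra.principalHom k M
  have hτ : ∀ x, x ≠ 0 → (τ x).unop ≠ 0 := fun x hx h =>
    hx (UniversalEnvelopingAlgebra.principalHom_injective k
      (MulOpposite.unop_injective (by rw [h, map_zero, MulOpposite.unop_zero])))
  obtain ⟨a', s', hs', h⟩ := hleft (τ a).unop (τ s).unop (hτ s hs)
  refine ⟨(τ a').unop, (τ s').unop, hτ s' hs', ?_⟩
  have h2 := congrArg (fun x => (τ x).unop) h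
  simp only [map_mul, MulOpposite.unop_mul] at h2
  rwa [UniversalEnvelopingAlgebra.principalHom_invol,
    UniversalEnvelopingAlgebra.principalHom_invol] at h2

end IsNoncommPlane

/-!
# A free pair of symmetric elements in the division ring of fractions of `U(M)`

Write `x` for the element `f` of `𝔇(M)`. The rational functions of `e` form a subfield `K ≅ k(X)` of
`𝔇(M)`, and `x g = σ(g) x` for `g ∈ K`, where `σ` is the shift `g(X) ↦ g(X - 1)`. Put
`a = 1 / ((e - 1/3) (e + 1/3))`. Since `s + s⁻¹ = 2 + (4/9) a`, freeness of `s + s⁻¹` and its conjugate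
by `u` is freeness of `a` and `u a u⁻¹`. With `y₊ = (1 + x)⁻¹` and `y₋ = (1 - x)⁻¹` one has
`u = 2 y₊ - 1` and `u⁻¹ = 2 y₋ - 1`.

The main point is `lift_signInv_mul_injective`: the elements `y₊ aⁿ` and `y₋ aⁿ` with `n ≥ 1` are free
generators of an algebra. In fact the words in them, followed by `y₊`, are left linearly independent
over `K` modulo `K[x]` (`eq_zero_of_wordSum_eq_eval₂`). For signs `δ`, `ε` and `y = (1 + ε x)⁻¹`,
`(1 + δ x) g y = (g - δ ε σ(g)) y + δ ε σ(g)`,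
so left multiplication by `1 + δ x` acts on combinations of words as a skew derivation that strips first
letters. As in the proof that iterated integrals are linearly independent, a shortest relation has
constant leading coefficients, and then a nonzero element of `a k[a]` has the form `g ± σ(g)`. This is
impossible (`eq_zero_of_aeval_poleFrac_eq`): the poles of `g` lying in one `ℤ`-orbit have two ends, and
both would produce poles of `g ± σ(g)`, at distinct points of one orbit, whereas `1/3` and `-1/3` lie
in different orbits; so `g` is a polynomial, but `a p(a)` is not one for `p ≠ 0`.

To pass from words in `y₊ aⁿ`, `y₋ aⁿ` to words in `a`, `u a u⁻¹`, let `p` be a noncommutative polynomial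
with `p(a, u a u⁻¹) = 0`. Eliminating `u` and `u⁻¹` writes `y₊ a p(a, u a u⁻¹) a` as a polynomial in the
free generators (`mul_mem_adjoin_of_conj`), which must be the zero polynomial. Hence
`y₊ a p(a, u a u⁻¹) a = 0` also holds for every other element `a` and unit `u` of a `k`-algebra, with
`y₊ = (1 + u) / 2`. For left multiplication by `x₀` and the shift on the free algebra on `xₙ`, `n ∈ ℤ`,
this forces `p = 0` (`eq_zero_of_add_freeShift_eq_zero`).
-/

/-! ### Rational functions and the shift -/

section RationalFunctions

open Polynomial

theorem Finset.exists_add_one_notMem {F : Type*} [Field F] [CharZero F] {s : Finset F} {x : F}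
    (hx : x ∈ s) : ∃ y ∈ s, y + 1 ∉ s := by
  by_contra! h
  have hmem : ∀ n : ℕ, x + n ∈ s := by
    intro n
    induction n with
    | zero => simpa using hx
    | succ n ih => simpa [add_assoc] using h _ ih
  have hinj : Function.Injective fun n : ℕ => x + (n : F) := fun m n hmn =>
    Nat.cast_injective (add_left_cancel hmn)
  exact Set.infinite_of_injective_forall_mem hinj hmem s.finite_toSet

/-- A nonempty finite set meets some `ℤ`-orbit in a set with a largest element `y` and a gap
below some `y - j`. -/
theorem Finset.exists_orbit_ends {F : Type*} [Field F] [CharZero F] {s : Finset F}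
    (hs : s.Nonempty) : ∃ y ∈ s, y + 1 ∉ s ∧ ∃ j : ℕ, y - j ∈ s ∧ y - j - 1 ∉ s := by
  classical
  obtain ⟨x, hx⟩ := hs
  obtain ⟨y, hy, hy1⟩ := Finset.exists_add_one_notMem hx
  refine ⟨y, hy, hy1, ?_⟩
  by_contra! h
  have hmem : ∀ n : ℕ, y - n ∈ s := by
    intro n
    induction n with
    | zero => simpa using hy
    | succ n ih => simpa [sub_sub] using h n ih
  have hinj : Function.Injective fun n : ℕ => y - (n : F) := fun m n hmn =>
    Nat.cast_injective (sub_right_injective hmn)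
  exact Set.infinite_of_injective_forall_mem hinj hmem s.finite_toSet

variable {k : Type*} [Field k]

/-- The denominator `d` of a rational function `n / d` is constant if the poles of
`n / d - c • (n / d)(X - 1)` lie among the roots of a polynomial `q`, no two of which
differ by a positive integer: the two ends of a `ℤ`-orbit of poles of `n / d` would both
survive in the difference. -/
theorem isUnit_denom_of_shift_sub [CharZero k] {n d b q : k[X]} (c : k) (hc : c ≠ 0) (hd : d ≠ 0)
    (hnd : IsCoprime n d)
    (hq : ∀ (z : AlgebraicClosure k) (j : ℕ), aeval z q = 0 → aeval (z + j + 1) q ≠ 0)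
    (h : q * (n * d.comp (X - C 1) - C c * n.comp (X - C 1) * d) = b * d * d.comp (X - C 1)) :
    IsUnit d := by
  classical
  by_contra hu
  let s : Finset (AlgebraicClosure k) := (d.aroots (AlgebraicClosure k)).toFinset
  have hs : ∀ z, z ∈ s ↔ aeval z d = 0 := fun z => by
    rw [Multiset.mem_toFinset, mem_aroots]
    exact ⟨fun h => h.2, fun h => ⟨hd, h⟩⟩
  have hne : s.Nonempty := by
    have hdeg : d.degree ≠ 0 := fun h0 => hu (isUnit_iff_degree_eq_zero.2 h0)
    obtain ⟨z, hz⟩ := IsAlgClosed.exists_aeval_eq_zero (AlgebraicClosure k) d hdeg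
    exact ⟨z, (hs z).2 hz⟩
  obtain ⟨y, hy, hy1, j, hj, hj1⟩ := Finset.exists_orbit_ends hne
  rw [hs] at hy hy1 hj hj1
  have hn : ∀ z : AlgebraicClosure k, aeval z d = 0 → aeval z n ≠ 0 := by
    intro z hz h0
    obtain ⟨a, b, hab⟩ := hnd
    have := congrArg (aeval z) hab
    simp [hz, h0] at this
  have hev : ∀ z : AlgebraicClosure k, aeval z q * (aeval z n * aeval (z - 1) d -
      algebraMap k _ c * aeval (z - 1) n * aeval z d) =
        aeval z b * aeval z d * aeval (z - 1) d := by
    intro z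
    have := congrArg (aeval z) h
    simpa [aeval_comp] using this
  have hc' : algebraMap k (AlgebraicClosure k) c ≠ 0 := by simpa using hc
  have q1 : aeval (y + 1) q = 0 := by
    have := hev (y + 1)
    rw [add_sub_cancel_right, hy, mul_zero, mul_zero, zero_sub] at this
    exact (mul_eq_zero.1 this).resolve_right (neg_ne_zero.2
      (mul_ne_zero (mul_ne_zero hc' (hn y hy)) hy1))
  have q2 : aeval (y - j) q = 0 := by
    have := hev (y - j)
    rw [hj, mul_zero, mul_zero, zero_mul, sub_zero] at this
    exact (mul_eq_zero.1 this).resolve_right (mul_ne_zero (hn _ hj) hj1)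
  refine hq _ j q2 ?_
  rwa [sub_add_cancel]

variable (k) in
/-- The automorphism `g(X) ↦ g(X - 1)` of the field of rational functions. -/
noncomputable def shiftFrac : FractionRing k[X] →+* FractionRing k[X] :=
  IsFractionRing.lift (A := k[X]) (g := (algebraMap k[X] (FractionRing k[X])).comp
    (compRingHom (X - C 1))) (by
      rw [RingHom.coe_comp]
      refine (IsFractionRing.injective _ _).comp ((injective_iff_map_eq_zero _).2 fun p hp => ?_)
      exact (IsNoncommPlane.iterate_comp_ne_zero 1).mtr hp)

theorem shiftFrac_algebraMap (p : k[X]) : shiftFrac k (algebraMap k[X] _ p) =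
    algebraMap k[X] _ (p.comp (X - C 1)) := by
  rw [shiftFrac, IsFractionRing.lift_algebraMap]; rfl

/-- If the poles of `g - c • g(X - 1)` lie among the roots of `q`, no two of which differ by a
positive integer, then `g` is a polynomial. -/
theorem exists_polynomial_of_shift_sub [CharZero k] {g : FractionRing k[X]} {b q : k[X]} (c : k) (hc : c ≠ 0)
    (hq : ∀ (z : AlgebraicClosure k) (j : ℕ), aeval z q = 0 → aeval (z + j + 1) q ≠ 0)
    (h : algebraMap k[X] _ q * (g - algebraMap k[X] _ (C c) * shiftFrac k g) =
      algebraMap k[X] _ b) :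
    ∃ p : k[X], g = algebraMap k[X] _ p := by
  obtain ⟨n, d, hnd, hg⟩ : ∃ n d : k[X], IsCoprime n d ∧ d ≠ 0 ∧
      g = algebraMap k[X] _ n / algebraMap k[X] _ d :=
    ⟨IsFractionRing.num k[X] g, IsFractionRing.den k[X] g,
      (IsFractionRing.num_den_reduced k[X] g).isCoprime,
      nonZeroDivisors.coe_ne_zero _, by
        exact (IsFractionRing.mk'_num_den' k[X] g).symm⟩
  obtain ⟨hd, hg⟩ := hg
  have hinj := IsFractionRing.injective k[X] (FractionRing k[X])
  have hd' : algebraMap k[X] (FractionRing k[X]) d ≠ 0 :=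
    (map_ne_zero_iff _ hinj).2 hd
  have hds : algebraMap k[X] (FractionRing k[X]) (d.comp (X - C 1)) ≠ 0 := by
    rw [← shiftFrac_algebraMap]
    exact (_root_.map_ne_zero _).2 hd'
  have hu : IsUnit d := by
    refine isUnit_denom_of_shift_sub (b := b) (q := q) c hc hd hnd hq (hinj ?_)
    rw [hg, map_div₀, shiftFrac_algebraMap, shiftFrac_algebraMap] at h
    simp only [map_mul, map_sub]
    rw [← h]
    field_simp
  obtain ⟨r, hr, rfl⟩ := Polynomial.isUnit_iff.1 hu
  refine ⟨n * C r⁻¹, ?_⟩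
  rw [hg, div_eq_iff hd', ← map_mul, mul_assoc, ← C_mul, inv_mul_cancel₀ hr.ne_zero, C_1, mul_one]

/-- A polynomial invariant under `X ↦ X - m`, for a positive integer `m`, is constant. -/
theorem eq_C_of_comp_X_sub [CharZero k] {p : k[X]} {m : ℕ} (hm : m ≠ 0) (h : p.comp (X - C (m : k)) = p) :
    p = C (p.eval 0) := by
  have hroot : ∀ i : ℕ, p.eval (-(i * m : k)) = p.eval 0 := by
    intro i
    induction i with
    | zero => simp
    | succ i ih =>
      rw [← ih]
      conv_rhs => rw [← h]
      rw [eval_comp, eval_sub, eval_X, eval_C]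
      congr 1
      push_cast
      ring
  refine eq_of_infinite_eval_eq _ _ (Set.infinite_of_injective_forall_mem
    (f := fun i : ℕ => -((i : k) * m)) (fun i j hij => ?_) fun i => ?_)
  · exact Nat.cast_injective (mul_right_cancel₀ (Nat.cast_ne_zero.2 hm) (neg_injective hij))
  · rw [Set.mem_ofPred_eq, hroot, eval_C]

theorem exists_polynomial_of_shiftFrac_eq [CharZero k] {g : FractionRing k[X]} (c : k) (hc : c ≠ 0)
    (h : g = algebraMap k[X] _ (C c) * shiftFrac k g) :
    ∃ p : k[X], g = algebraMap k[X] _ p :=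
  exists_polynomial_of_shift_sub (b := 0) (q := 1) c hc (by simp) (by
    rw [← h, sub_self, mul_zero, map_zero])

theorem exists_const_of_shiftFrac_eq [CharZero k] {g : FractionRing k[X]} (h : shiftFrac k g = g) :
    ∃ c : k, g = algebraMap k _ c := by
  obtain ⟨p, rfl⟩ := exists_polynomial_of_shiftFrac_eq (g := g) 1 one_ne_zero
    (by rw [h, C_1, map_one, one_mul])
  rw [shiftFrac_algebraMap] at h
  have h1 := eq_C_of_comp_X_sub (m := 1) one_ne_zero
    (by simpa only [Nat.cast_one] using IsFractionRing.injective k[X] (FractionRing k[X]) h)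
  refine ⟨p.eval 0, ?_⟩
  conv_lhs => rw [h1]
  exact (IsScalarTower.algebraMap_apply k k[X] (FractionRing k[X]) _).symm

theorem eq_zero_of_shiftFrac_eq_neg [CharZero k] {g : FractionRing k[X]} (h : shiftFrac k g = -g) : g = 0 := by
  obtain ⟨p, rfl⟩ := exists_polynomial_of_shiftFrac_eq (g := g) (-1)
    (neg_ne_zero.2 one_ne_zero) (by rw [h, C_neg, C_1, map_neg, map_one, neg_mul_neg, one_mul])
  rw [shiftFrac_algebraMap, ← map_neg] at h
  have h1 := IsFractionRing.injective k[X] (FractionRing k[X]) h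
  have h2 : p.comp (X - C ((2 : ℕ) : k)) = p := by
    conv_rhs => rw [← neg_neg p, ← h1, ← neg_comp, ← h1, comp_assoc]
    congr 1
    rw [sub_comp, X_comp, C_comp, sub_sub, ← C_add, one_add_one_eq_two, Nat.cast_ofNat]
  have h3 := eq_C_of_comp_X_sub two_ne_zero h2
  rw [h3, C_comp, ← C_neg, C_inj] at h1
  rw [h3, self_eq_neg.1 h1, C_0, map_zero]

/-- The polynomial `(X - 1/3) (X + 1/3)`. -/
noncomputable def poleDenom (k : Type*) [Field k] : k[X] := (X - C (1 / 3)) * (X + C (1 / 3))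

theorem poleDenom_ne_zero : poleDenom k ≠ 0 :=
  mul_ne_zero (X_sub_C_ne_zero _) (X_add_C_ne_zero _)

theorem eval_poleDenom : (poleDenom k).eval (1 / 3) = 0 := by simp [poleDenom]

/-- The roots `1/3` and `-1/3` lie in different `ℤ`-orbits. -/
theorem aeval_poleDenom_shift_ne_zero [CharZero k] (z : AlgebraicClosure k) (j : ℕ)
    (h : aeval z (poleDenom k) = 0) : aeval (z + j + 1) (poleDenom k) ≠ 0 := by
  intro h'
  have : CharZero (AlgebraicClosure k) := charZero_of_injective_algebraMap
    (algebraMap k (AlgebraicClosure k)).injective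
  simp only [poleDenom, map_mul, map_sub, map_add, aeval_X, aeval_C, map_div₀, map_one,
    map_ofNat, mul_eq_zero] at h h'
  have key : ∀ m : ℤ, 3 * (j + 1) = m → (m : AlgebraicClosure k) ≠ 0 := by
    intro m hm
    exact Int.cast_ne_zero.2 (by omega)
  have k0 : (3 * (j + 1) : ℤ) ≠ 0 := by omega
  have k1 : (3 * (j + 1) - 2 : ℤ) ≠ 0 := by omega
  have k2 : (3 * (j + 1) + 2 : ℤ) ≠ 0 := by omega
  rw [← Int.cast_ne_zero (α := AlgebraicClosure k)] at k0 k1 k2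
  push_cast at k0 k1 k2
  rcases h with h | h <;> rcases h' with h' | h'
  · exact k0 (by linear_combination 3 * h' - 3 * h)
  · exact k2 (by linear_combination 3 * h' - 3 * h)
  · exact k1 (by linear_combination 3 * h' - 3 * h)
  · exact k0 (by linear_combination 3 * h' - 3 * h)

variable (k) in
/-- The rational function `1 / ((X - 1/3) (X + 1/3))`. -/
noncomputable def poleFrac : FractionRing k[X] := (algebraMap k[X] _ (poleDenom k))⁻¹

theorem poleDenom_mul_poleFrac :
    algebraMap k[X] (FractionRing k[X]) (poleDenom k) * poleFrac k = 1 :=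
  mul_inv_cancel₀ ((map_ne_zero_iff _ (IsFractionRing.injective k[X] _)).2 poleDenom_ne_zero)

theorem exists_polynomial_of_aeval_poleFrac (p : k[X]) : ∃ b : k[X],
    algebraMap k[X] _ (poleDenom k ^ (p.natDegree + 1)) * (aeval (poleFrac k) p * poleFrac k) =
      algebraMap k[X] _ b ∧ b.eval (1 / 3) = p.leadingCoeff := by
  refine ⟨∑ i ∈ Finset.range (p.natDegree + 1),
    C (p.coeff i) * poleDenom k ^ (p.natDegree - i), ?_, ?_⟩
  · rw [aeval_eq_sum_range, map_sum, Finset.sum_mul, Finset.mul_sum]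
    refine Finset.sum_congr rfl fun i hi => ?_
    have hi' : i ≤ p.natDegree := Nat.lt_succ_iff.1 (Finset.mem_range.1 hi)
    have hC : algebraMap k (FractionRing k[X]) (p.coeff i) =
      algebraMap k[X] _ (C (p.coeff i)) := IsScalarTower.algebraMap_apply k k[X] _ _
    have h1 : (algebraMap k[X] (FractionRing k[X]) (poleDenom k)) ^ (p.natDegree + 1) =
        (algebraMap k[X] (FractionRing k[X]) (poleDenom k)) ^ (p.natDegree - i) *
        (algebraMap k[X] (FractionRing k[X]) (poleDenom k)) ^ (i + 1) := by
      rw [← pow_add]; congr 1; omega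
    rw [Algebra.smul_def, hC, map_mul, map_pow, map_pow, h1, mul_assoc _ (poleFrac k ^ i),
      ← pow_succ, mul_left_comm, mul_assoc, ← mul_pow, poleDenom_mul_poleFrac, one_pow, mul_one]
  · rw [eval_finsetSum, Finset.sum_range_succ, Finset.sum_eq_zero]
    · rw [zero_add, Nat.sub_self, pow_zero, mul_one, eval_C, coeff_natDegree]
    · intro i hi
      have hi' := Finset.mem_range.1 hi
      rw [eval_mul, eval_pow, eval_poleDenom, zero_pow (by omega), mul_zero]

/-- No nonzero element of `a k[a]`, with `a = 1 / ((X - 1/3) (X + 1/3))`, has the form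
`g - c • g(X - 1)` with a nonzero constant `c`. -/
theorem eq_zero_of_aeval_poleFrac_eq [CharZero k] (p : k[X]) (c : k) (hc : c ≠ 0) (g : FractionRing k[X])
    (h : aeval (poleFrac k) p * poleFrac k = g - algebraMap k _ c * shiftFrac k g) : p = 0 := by
  obtain ⟨b, hb, hb'⟩ := exists_polynomial_of_aeval_poleFrac p
  rw [IsScalarTower.algebraMap_apply k k[X]] at h
  change _ = g - algebraMap k[X] _ (C c) * _ at h
  rw [h] at hb
  obtain ⟨q, rfl⟩ := exists_polynomial_of_shift_sub c hc (fun z j h0 => by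
    rw [map_pow] at h0 ⊢
    exact pow_ne_zero _ (aeval_poleDenom_shift_ne_zero z j (eq_zero_of_pow_eq_zero h0))) hb
  rw [shiftFrac_algebraMap, ← map_mul, ← map_sub, ← map_mul] at hb
  have := congrArg (eval (1 / 3)) (IsFractionRing.injective k[X] (FractionRing k[X]) hb)
  rw [eval_mul, eval_pow, eval_poleDenom, zero_pow (Nat.succ_ne_zero _), zero_mul, hb'] at this
  exact leadingCoeff_eq_zero.1 this.symm

end RationalFunctions

/-! ### Independence of words in a skew polynomial extension -/

section SkewWords

open Polynomial

variable {K D I : Type*} [Field K] [DivisionRing D] (σ : K →+* K) (ι : K →+* D) (x : D)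
  (v : I → K)

/-- The element `(1 + ε x)⁻¹`, for a sign `ε`. -/
noncomputable def signInv (ε : ℤˣ) : D := (1 + ((ε : ℤ) : D) * x)⁻¹

/-- The product of the factors `(1 + ε x)⁻¹ v i` over the letters `(ε, i)` of a word, followed
by `(1 + x)⁻¹`. -/
noncomputable def wordProd : List (ℤˣ × I) → D
  | [] => signInv x 1
  | z :: l => signInv x z.1 * ι (v z.2) * wordProd l

/-- The sign in the leftmost factor of `wordProd`. -/
def headSign : List (ℤˣ × I) → ℤˣ
  | [] => 1
  | z :: _ => z.1

/-- What remains of `wordProd` when its leftmost factor is removed. -/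
noncomputable def wordRest : List (ℤˣ × I) → D
  | [] => 1
  | z :: l => ι (v z.2) * wordProd ι x v l

theorem wordProd_eq (w : List (ℤˣ × I)) :
    wordProd ι x v w = signInv x (headSign w) * wordRest ι x v w := by
  cases w with
  | nil => simp [wordProd, wordRest, headSign]
  | cons z l => simp [wordProd, wordRest, headSign, mul_assoc]

/-- The left `K`-linear combination of the products `wordProd w`. -/
noncomputable def wordSum (g : List (ℤˣ × I) →₀ K) : D :=
  g.sum fun w c => ι c * wordProd ι x v w

theorem wordSum_add (g h : List (ℤˣ × I) →₀ K) :
    wordSum ι x v (g + h) = wordSum ι x v g + wordSum ι x v h :=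
  Finsupp.sum_add_index' (by simp) (by simp [add_mul])

theorem wordSum_single (w : List (ℤˣ × I)) (c : K) :
    wordSum ι x v (Finsupp.single w c) = ι c * wordProd ι x v w :=
  Finsupp.sum_single_index (by simp)

theorem wordSum_zero : wordSum ι x v (0 : List (ℤˣ × I) →₀ K) = 0 := Finsupp.sum_zero_index

theorem wordSum_smul (c : K) (g : List (ℤˣ × I) →₀ K) :
    wordSum ι x v (c • g) = ι c * wordSum ι x v g := by
  rw [wordSum, wordSum, Finsupp.sum_smul_index' (by simp), Finsupp.mul_sum]
  simp [mul_assoc]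

/-- The contribution of a word to the shorter word without its first letter, in the expansion
of `(1 + δ x) * wordSum g`. -/
noncomputable def tailTerm (δ : ℤˣ) : List (ℤˣ × I) → K → (List (ℤˣ × I) →₀ K)
  | [], _ => 0
  | z :: l, c => Finsupp.single l (((δ * z.1 : ℤˣ) : ℤ) * σ c * v z.2)

/-- The coefficients of `(1 + δ x) * wordSum g`, modulo polynomials in `x`. -/
noncomputable def skewDiff (δ : ℤˣ) (g : List (ℤˣ × I) →₀ K) : List (ℤˣ × I) →₀ K :=
  g.sum fun w c => Finsupp.single w (c - ((δ * headSign w : ℤˣ) : ℤ) * σ c) + tailTerm σ v δ w c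

theorem tailTerm_zero (δ : ℤˣ) (w : List (ℤˣ × I)) : tailTerm σ v δ w 0 = 0 := by
  cases w <;> simp [tailTerm]

theorem tailTerm_add (δ : ℤˣ) (w : List (ℤˣ × I)) (c d : K) :
    tailTerm σ v δ w (c + d) = tailTerm σ v δ w c + tailTerm σ v δ w d := by
  cases w <;> simp [tailTerm, mul_add, add_mul]

theorem skewDiff_single (δ : ℤˣ) (w : List (ℤˣ × I)) (c : K) :
    skewDiff σ v δ (Finsupp.single w c) =
      Finsupp.single w (c - ((δ * headSign w : ℤˣ) : ℤ) * σ c) + tailTerm σ v δ w c :=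
  Finsupp.sum_single_index (by simp [tailTerm_zero])

theorem skewDiff_zero (δ : ℤˣ) : skewDiff σ v δ 0 = 0 := Finsupp.sum_zero_index

theorem skewDiff_add (δ : ℤˣ) (g h : List (ℤˣ × I) →₀ K) :
    skewDiff σ v δ (g + h) = skewDiff σ v δ g + skewDiff σ v δ h :=
  Finsupp.sum_add_index' (by simp [tailTerm_zero]) (fun w c d => by
    rw [tailTerm_add, map_add, mul_add, add_sub_add_comm, Finsupp.single_add]; abel)

theorem sum_single_headSign_apply (δ : ℤˣ) (g : List (ℤˣ × I) →₀ K) (w : List (ℤˣ × I)) :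
    (g.sum fun w' c => Finsupp.single w' (c - ((δ * headSign w' : ℤˣ) : ℤ) * σ c) w) =
      g w - ((δ * headSign w : ℤˣ) : ℤ) * σ (g w) := by
  classical
  rw [Finsupp.sum, Finset.sum_eq_single w]
  · rw [Finsupp.single_eq_same]
  · intro w' _ hne
    exact Finsupp.single_eq_of_ne' hne
  · intro hw
    simp [Finsupp.notMem_support_iff.1 hw]

theorem skewDiff_apply (δ : ℤˣ) (g : List (ℤˣ × I) →₀ K) (w : List (ℤˣ × I)) :
    skewDiff σ v δ g w = g w - ((δ * headSign w : ℤˣ) : ℤ) * σ (g w) +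
      g.sum fun w' c => tailTerm σ v δ w' c w := by
  rw [skewDiff, Finsupp.sum_apply, ← sum_single_headSign_apply]
  exact Finsupp.sum_add

theorem List.cons_pair_injective {α β : Type*} (a : α) (l : List (α × β)) :
    Function.Injective fun b : β => (a, b) :: l := fun b c h => by simpa using h

/-- If all words of the support of `g` that extend `w` by one letter do so by a letter of
sign `ε`, only these contribute to the coefficient of `w` in `skewDiff`. -/
theorem sum_tailTerm_apply (δ ε : ℤˣ) (g : List (ℤˣ × I) →₀ K) (w : List (ℤˣ × I))
    (h : ∀ ε' i, ε' ≠ ε → g ((ε', i) :: w) = 0) :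
    (g.sum fun w' c => tailTerm σ v δ w' c w) =
      (g.comapDomain (fun i => (ε, i) :: w) (List.cons_pair_injective ε w).injOn).sum
        fun i c => ((δ * ε : ℤˣ) : ℤ) * σ c * v i := by
  classical
  rw [Finsupp.sum, Finsupp.sum, Finsupp.comapDomain_support]
  rw [← Finset.sum_preimage (fun i => (ε, i) :: w) g.support
    (List.cons_pair_injective ε w).injOn]
  · refine Finset.sum_congr rfl fun i _ => ?_
    simp [tailTerm]
  · rintro (_ | ⟨⟨ε', i⟩, l⟩) hl hr
    · rfl
    · rw [tailTerm]
      refine Finsupp.single_eq_of_ne' ?_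
      rintro rfl
      by_cases hε : ε' = ε
      · subst hε
        exact hr ⟨i, rfl⟩
      · exact Finsupp.mem_support_iff.1 hl (h ε' i hε)

variable {σ ι x}

theorem mul_eval₂_skew (hx : ∀ c, x * ι c = ι (σ c) * x) (q : K[X]) :
    x * q.eval₂ ι x = (q.map σ * X).eval₂ ι x := by
  rw [eval₂_mul_X]
  induction q using Polynomial.induction_on' with
  | add p q hp hq => rw [eval₂_add, mul_add, hp, hq, Polynomial.map_add, eval₂_add, add_mul]
  | monomial n c =>
    rw [eval₂_monomial, map_monomial, eval₂_monomial, ← mul_assoc, hx, mul_assoc, mul_assoc,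
      ← pow_succ, ← pow_succ']

theorem eval₂_C_mul_skew (c : K) (q : K[X]) : (C c * q).eval₂ ι x = ι c * q.eval₂ ι x := by
  induction q using Polynomial.induction_on' with
  | add p q hp hq => rw [mul_add, eval₂_add, eval₂_add, hp, hq, mul_add]
  | monomial n d => rw [C_mul_monomial, eval₂_monomial, eval₂_monomial, map_mul, mul_assoc]

theorem exists_mul_eval₂_skew (hx : ∀ c, x * ι c = ι (σ c) * x) (δ : ℤˣ) (q : K[X]) :
    ∃ q' : K[X], (1 + ((δ : ℤ) : D) * x) * q.eval₂ ι x = q'.eval₂ ι x := by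
  refine ⟨q + C ((δ : ℤ) : K) * (q.map σ * X), ?_⟩
  rw [eval₂_add, eval₂_C_mul_skew, ← mul_eval₂_skew hx, map_intCast, add_mul, one_mul, mul_assoc]

theorem one_add_mul_ne_zero (hinj : ∀ q : K[X], q.eval₂ ι x = 0 → q = 0) (ε : ℤˣ) :
    1 + ((ε : ℤ) : D) * x ≠ 0 := by
  intro h
  have h1 := hinj (1 + C ((ε : ℤ) : K) * X) (by
    rw [eval₂_add, eval₂_one, eval₂_mul_X, eval₂_C, map_intCast, h])
  have h2 := congrArg (coeff · 0) h1
  simp at h2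

/-- The identity `x (1 + ε x)⁻¹ = ε (1 - (1 + ε x)⁻¹)` makes left multiplication by `1 + δ x` a skew
derivation on `K (1 + ε x)⁻¹`, up to a term in `K`. -/
theorem one_add_mul_signInv (hx : ∀ c, x * ι c = ι (σ c) * x)
    (hinj : ∀ q : K[X], q.eval₂ ι x = 0 → q = 0) (δ ε : ℤˣ) (c : K) :
    (1 + ((δ : ℤ) : D) * x) * (ι c * signInv x ε) =
      ι (c - ((δ * ε : ℤˣ) : ℤ) * σ c) * signInv x ε + ι (((δ * ε : ℤˣ) : ℤ) * σ c) := by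
  have hε := one_add_mul_ne_zero hinj ε
  apply mul_right_cancel₀ hε
  have h1 : signInv x ε * (1 + ((ε : ℤ) : D) * x) = 1 := inv_mul_cancel₀ hε
  rw [add_mul _ _ (1 + ((ε : ℤ) : D) * x), mul_assoc, mul_assoc, mul_assoc, h1, mul_one, mul_one,
    add_mul, one_mul, mul_assoc, hx]
  rcases Int.units_eq_one_or δ with rfl | rfl <;> rcases Int.units_eq_one_or ε with rfl | rfl <;>
    simp <;> noncomm_ring

/-- Left multiplication by `1 + δ x` acts on combinations of words, modulo polynomials in `x`, as
the skew derivation `skewDiff δ`. -/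
theorem exists_one_add_mul_wordSum (hx : ∀ c, x * ι c = ι (σ c) * x)
    (hinj : ∀ q : K[X], q.eval₂ ι x = 0 → q = 0) (δ : ℤˣ) (g : List (ℤˣ × I) →₀ K) :
    ∃ q : K[X], (1 + ((δ : ℤ) : D) * x) * wordSum ι x v g =
      wordSum ι x v (skewDiff σ v δ g) + q.eval₂ ι x := by
  induction g using Finsupp.induction_linear with
  | zero => exact ⟨0, by simp [skewDiff_zero, wordSum_zero]⟩
  | add g h hg hh =>
    obtain ⟨p, hp⟩ := hg
    obtain ⟨q, hq⟩ := hh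
    refine ⟨p + q, ?_⟩
    rw [wordSum_add, mul_add, hp, hq, skewDiff_add, wordSum_add, eval₂_add]
    abel
  | single w c =>
    have h : (1 + ((δ : ℤ) : D) * x) * (ι c * wordProd ι x v w) =
        ι (c - ((δ * headSign w : ℤˣ) : ℤ) * σ c) * wordProd ι x v w +
          ι (((δ * headSign w : ℤˣ) : ℤ) * σ c) * wordRest ι x v w := by
      rw [wordProd_eq, ← mul_assoc (ι c), ← mul_assoc, one_add_mul_signInv hx hinj, add_mul,
        mul_assoc]
    rw [wordSum_single, h, skewDiff_single, wordSum_add, wordSum_single]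
    cases w with
    | nil => exact ⟨C (((δ * headSign ([] : List (ℤˣ × I)) : ℤˣ) : ℤ) * σ c), by
        rw [eval₂_C, tailTerm, wordSum_zero, wordRest, add_zero, mul_one]⟩
    | cons z l => exact ⟨0, by
        rw [eval₂_zero, tailTerm, wordSum_single, wordRest, headSign, map_mul ι _ (v z.2),
          add_zero, mul_assoc]⟩

theorem skewDiff_apply_of_forall (δ : ℤˣ) (g : List (ℤˣ × I) →₀ K) (w : List (ℤˣ × I))
    (h : ∀ z, g (z :: w) = 0) :
    skewDiff σ v δ g w = g w - ((δ * headSign w : ℤˣ) : ℤ) * σ (g w) := by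
  rw [skewDiff_apply, sum_tailTerm_apply σ v δ 1 g w fun _ _ _ => h _, Finsupp.sum,
    Finset.sum_eq_zero, add_zero]
  intro i _
  rw [Finsupp.comapDomain_apply, h]
  simp

/-- If `skewDiff ε g = 0` and `g` lives on words of length at most that of `(ε, i) :: w₁`, then the
coefficients of the words of this length are invariant under `± σ`, so those of `(ε', i) :: w₁` with
`ε' ≠ ε` vanish and those of `(ε, i) :: w₁` are scalars; the coefficient of `w₁` in
`skewDiff ε g = 0` then expresses a combination of the `v i` as `c ± σ c`. -/
theorem apply_cons_eq_zero_of_skewDiff_eq_zero {k : Type*} [Field k] [Algebra k K]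
    (hfix : ∀ c, σ c = c → ∃ r : k, c = algebraMap k K r) (hneg : ∀ c, σ c = -c → c = 0)
    (hv : ∀ (r : I →₀ k) (c : K) (ε : ℤˣ),
      (r.sum fun i r => algebraMap k K r * v i) = c - (ε : ℤ) * σ c → r = 0)
    (g : List (ℤˣ × I) →₀ K) (ε : ℤˣ) (w₁ : List (ℤˣ × I))
    (hlen : ∀ w, w₁.length + 1 < w.length → g w = 0) (hdiff : skewDiff σ v ε g = 0) (i₀ : I) :
    g ((ε, i₀) :: w₁) = 0 := by
  have hlong : ∀ z, g (z :: w₁) - ((ε * z.1 : ℤˣ) : ℤ) * σ (g (z :: w₁)) = 0 := by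
    intro z
    have h := skewDiff_apply_of_forall (σ := σ) v ε g (z :: w₁) fun z' => hlen _ (by simp)
    rw [hdiff] at h
    exact h.symm
  have hopp : ∀ ε' i, ε' ≠ ε → g ((ε', i) :: w₁) = 0 := by
    intro ε' i hne
    have h := hlong (ε', i)
    refine hneg _ ?_
    have hε' : ε' = -ε := Int.units_ne_iff_eq_neg.1 hne
    rw [hε', mul_neg, Int.units_mul_self] at h
    rw [hε']
    simp only [Units.val_neg, Units.val_one, Int.cast_neg,
      Int.cast_one, neg_mul, one_mul, sub_neg_eq_add] at h
    exact (neg_eq_of_add_eq_zero_right h).symm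
  have hconst : ∀ i, ∃ r : k, g ((ε, i) :: w₁) = algebraMap k K r := by
    intro i
    have h := hlong (ε, i)
    rw [Int.units_mul_self] at h
    refine hfix _ ?_
    simp only [Units.val_one, Int.cast_one, one_mul] at h
    exact (sub_eq_zero.1 h).symm
  choose r hr using hconst
  let r' : I →₀ k := Finsupp.onFinset
    (g.comapDomain (fun i => (ε, i) :: w₁) (List.cons_pair_injective ε w₁).injOn).support r
    fun i hi => by
      rw [Finsupp.mem_support_iff, Finsupp.comapDomain_apply, hr]
      simpa using hi
  have hr0 : r' = 0 := by
    refine hv r' (-g w₁) (ε * headSign w₁) ?_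
    have h := skewDiff_apply σ v ε g w₁
    rw [hdiff, sum_tailTerm_apply σ v ε ε g w₁ hopp, Finsupp.coe_zero, Pi.zero_apply] at h
    have hs : (r'.sum fun i r => algebraMap k K r * v i) =
        (g.comapDomain (fun i => (ε, i) :: w₁) (List.cons_pair_injective ε w₁).injOn).sum
          fun i c => ((ε * ε : ℤˣ) : ℤ) * σ c * v i := by
      rw [Finsupp.onFinset_sum _ (by simp), Finsupp.sum]
      refine Finset.sum_congr rfl fun i _ => ?_
      have h := hlong (ε, i)
      rw [Int.units_mul_self] at h
      simp only [Units.val_one, Int.cast_one, one_mul] at h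
      rw [Finsupp.comapDomain_apply, Int.units_mul_self, Units.val_one, Int.cast_one, one_mul,
        ← sub_eq_zero.1 h, hr]
    rw [hs, map_neg, mul_neg, sub_neg_eq_add, neg_add_eq_sub, eq_comm, ← sub_eq_zero,
      ← sub_eq_zero.2 h]
    ring
  rw [hr]
  exact (congrArg _ (DFunLike.congr_fun hr0 i₀)).trans (map_zero _)

/-- The products `wordProd w` are left linearly independent over `K` modulo polynomials in `x`,
when `σ` fixes only scalars, does not take the value `-c` at any `c ≠ 0`, and no nontrivial
combination of the `v i` over `k` has the form `c ± σ c`.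
When a coefficient of a longest word of a relation is normalised to be `1`, left multiplication by
`1 + ε x`, with `ε` the first sign of this word, yields a relation with fewer words of this length. By
induction it is trivial, and `apply_cons_eq_zero_of_skewDiff_eq_zero` gives a contradiction. -/
theorem eq_zero_of_wordSum_eq_eval₂ {k : Type*} [Field k] [Algebra k K]
    (hx : ∀ c, x * ι c = ι (σ c) * x) (hinj : ∀ q : K[X], q.eval₂ ι x = 0 → q = 0)
    (hfix : ∀ c, σ c = c → ∃ r : k, c = algebraMap k K r) (hneg : ∀ c, σ c = -c → c = 0)
    (hv : ∀ (r : I →₀ k) (c : K) (ε : ℤˣ),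
      (r.sum fun i r => algebraMap k K r * v i) = c - (ε : ℤ) * σ c → r = 0)
    (g : List (ℤˣ × I) →₀ K) (q : K[X]) (hg : wordSum ι x v g = q.eval₂ ι x) : g = 0 := by
  classical
  -- Induction on a bound `n` for the lengths, then on the number of words of length `n`.
  suffices H : ∀ (n m : ℕ) (g : List (ℤˣ × I) →₀ K) (q : K[X]),
      wordSum ι x v g = q.eval₂ ι x → (∀ w, n < w.length → g w = 0) →
      (g.support.filter fun w => w.length = n).card ≤ m → g = 0 by
    refine H (g.support.sup List.length) _ g q hg (fun w hw => ?_) le_rfl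
    by_contra h
    exact absurd (Finset.le_sup (f := List.length) (Finsupp.mem_support_iff.2 h)) (not_le.2 hw)
  intro n
  induction n with
  | zero =>
    intro m g q hg hlen _
    have hgs : g = Finsupp.single [] (g []) := by
      ext w
      cases w with
      | nil => rw [Finsupp.single_eq_same]
      | cons z l => rw [hlen _ (by simp), Finsupp.single_eq_of_ne (by simp)]
    -- The relation is `c (1 + x)⁻¹ = q(x)`, which is impossible for reasons of degree if `c ≠ 0`.
    rw [hgs, wordSum_single, wordProd, signInv,
      ← div_eq_mul_inv, div_eq_iff (one_add_mul_ne_zero hinj 1)] at hg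
    have h := hinj (C (g []) - q * (1 + X)) (by
      rw [mul_add, mul_one, eval₂_sub, eval₂_add, eval₂_mul_X, eval₂_C, hg]
      simp [mul_add])
    have h0 : q = 0 := by
      by_contra hq
      have hd := congrArg natDegree (sub_eq_zero.1 h)
      have hX : (1 + X : K[X]) = X + C 1 := by rw [C_1, add_comm]
      rw [natDegree_C, hX, natDegree_mul hq (X_add_C_ne_zero 1), natDegree_X_add_C] at hd
      omega
    rw [h0, zero_mul, sub_zero, C_eq_zero] at h
    rw [hgs, h, Finsupp.single_zero]
  | succ n ihn =>
    intro m
    induction m with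
    | zero =>
      intro g q hg hlen hcard
      refine ihn _ g q hg (fun w hw => ?_) le_rfl
      rcases (Nat.succ_le_of_lt hw).lt_or_eq with h | h
      · exact hlen w h
      · by_contra h0
        have : w ∈ g.support.filter fun w => w.length = n + 1 :=
          Finset.mem_filter.2 ⟨Finsupp.mem_support_iff.2 h0, h.symm⟩
        rw [Finset.card_eq_zero.1 (Nat.le_zero.1 hcard)] at this
        exact Finset.notMem_empty _ this
    | succ m ihm =>
      intro g q hg hlen hcard
      by_cases htop : ∃ w, w.length = n + 1 ∧ g w ≠ 0
      swap
      · refine ihm g q hg hlen ?_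
        push Not at htop
        rw [Finset.filter_eq_empty_iff.2 fun w hw h => Finsupp.mem_support_iff.1 hw (htop w h)]
        simp
      obtain ⟨w₀, hw₀, hgw₀⟩ := htop
      obtain _ | ⟨⟨ε, i₀⟩, w₁⟩ := w₀
      · simp at hw₀
      exfalso
      -- Normalise the coefficient of `w₀` to be `1`.
      let g' : List (ℤˣ × I) →₀ K := (g ((ε, i₀) :: w₁))⁻¹ • g
      have hg'w₀ : g' ((ε, i₀) :: w₁) = 1 := by
        simp only [g', Finsupp.smul_apply, smul_eq_mul]
        exact inv_mul_cancel₀ hgw₀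
      have hg'len : ∀ w, n + 1 < w.length → g' w = 0 := fun w hw => by
        simp only [g', Finsupp.smul_apply, hlen w hw, smul_zero]
      have hg'supp : ∀ w, g w = 0 → g' w = 0 := fun w hw => by
        simp only [g', Finsupp.smul_apply, hw, smul_zero]
      have hlong : ∀ (w : List (ℤˣ × I)), n + 1 ≤ w.length →
          skewDiff σ v ε g' w = g' w - ((ε * headSign w : ℤˣ) : ℤ) * σ (g' w) := fun w hw =>
        skewDiff_apply_of_forall v ε g' w fun z => hg'len _ (by
          rw [List.length_cons]; omega)
      -- The coefficient of `w₀` disappears from `skewDiff ε g'`, which vanishes by induction.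
      have hdiff : skewDiff σ v ε g' = 0 := by
        obtain ⟨p, hp⟩ := exists_one_add_mul_wordSum v hx hinj ε g'
        obtain ⟨p', hp'⟩ := exists_mul_eval₂_skew hx ε (C (g ((ε, i₀) :: w₁))⁻¹ * q)
        refine ihm _ (p' - p) ?_ (fun w hw => ?_) ?_
        · rw [eval₂_sub, ← hp', eq_sub_iff_add_eq, ← hp, wordSum_smul, hg, ← eval₂_C_mul_skew]
        · rw [hlong w (by omega), hg'len w hw]; simp
        · rw [← Nat.lt_succ_iff]
          refine (Finset.card_lt_card ?_).trans_le hcard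
          refine (Finset.ssubset_iff_of_subset ?_).2 ⟨(ε, i₀) :: w₁, ?_, ?_⟩
          · intro w hw
            rw [Finset.mem_filter, Finsupp.mem_support_iff] at hw ⊢
            refine ⟨fun h0 => hw.1 ?_, hw.2⟩
            rw [hlong w hw.2.ge, hg'supp w h0]; simp
          · exact Finset.mem_filter.2 ⟨Finsupp.mem_support_iff.2 hgw₀, hw₀⟩
          · rw [Finset.mem_filter, Finsupp.mem_support_iff, hlong _ hw₀.ge, hg'w₀]
            simp [headSign]
      have h0 := apply_cons_eq_zero_of_skewDiff_eq_zero v hfix hneg hv g' ε w₁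
        (fun w hw => hg'len w (by rw [List.length_cons] at hw₀; omega)) hdiff i₀
      exact one_ne_zero (hg'w₀.symm.trans h0)

/-- Under the same hypotheses, the elements `(1 + ε x)⁻¹ v i` freely generate an algebra. -/
theorem lift_signInv_mul_injective {k : Type*} [Field k] [Algebra k K] [Algebra k D]
    (hk : ∀ r : k, ι (algebraMap k K r) = algebraMap k D r)
    (hx : ∀ c, x * ι c = ι (σ c) * x) (hinj : ∀ q : K[X], q.eval₂ ι x = 0 → q = 0)
    (hfix : ∀ c, σ c = c → ∃ r : k, c = algebraMap k K r) (hneg : ∀ c, σ c = -c → c = 0)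
    (hv : ∀ (r : I →₀ k) (c : K) (ε : ℤˣ),
      (r.sum fun i r => algebraMap k K r * v i) = c - (ε : ℤ) * σ c → r = 0) :
    Function.Injective
      (FreeAlgebra.lift k fun z : ℤˣ × I => signInv x z.1 * ι (v z.2)) := by
  -- Right multiplication by `(1 + x)⁻¹` turns monomials into the products `wordProd w`.
  rw [injective_iff_map_eq_zero]
  intro N hN
  obtain ⟨m, rfl⟩ := (FreeAlgebra.equivMonoidAlgebraFreeMonoid (R := k)
    (X := ℤˣ × I)).symm.surjective N
  have hword : ∀ w : List (ℤˣ × I), FreeAlgebra.lift k (fun z : ℤˣ × I =>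
      signInv x z.1 * ι (v z.2)) (FreeMonoid.lift (FreeAlgebra.ι k) (FreeMonoid.ofList w)) *
        signInv x 1 = wordProd ι x v w := by
    intro w
    induction w with
    | nil => simp [wordProd]
    | cons z l ih =>
      rw [FreeMonoid.ofList_cons, map_mul, map_mul, FreeMonoid.lift_eval_of, FreeAlgebra.lift_ι_apply,
        mul_assoc, ih, wordProd]
  have hsum : wordSum ι x v ((m.coeff.mapRange (algebraMap k K) (map_zero _)).mapDomain
      FreeMonoid.toList) =
      FreeAlgebra.lift k (fun z : ℤˣ × I => signInv x z.1 * ι (v z.2))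
        (FreeAlgebra.equivMonoidAlgebraFreeMonoid.symm m) * signInv x 1 := by
    change _ = FreeAlgebra.lift k (fun z : ℤˣ × I => signInv x z.1 * ι (v z.2))
      (MonoidAlgebra.lift k (FreeAlgebra k (ℤˣ × I)) (FreeMonoid (ℤˣ × I))
        (FreeMonoid.lift (FreeAlgebra.ι k)) m) * signInv x 1
    rw [MonoidAlgebra.lift_apply, Finsupp.sum, map_sum, Finset.sum_mul, wordSum,
      Finsupp.sum_mapDomain_index_inj FreeMonoid.toList.injective,
      Finsupp.sum_mapRange_index (by simp), Finsupp.sum]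
    refine Finset.sum_congr rfl fun w _ => ?_
    rw [map_smul, smul_mul_assoc, Algebra.smul_def, hk]
    exact congrArg _ (hword w).symm
  have h0 := eq_zero_of_wordSum_eq_eval₂ v hx hinj hfix hneg hv _ 0
    (hsum.trans (by rw [hN, zero_mul, eval₂_zero]))
  have hm : m = 0 := by
    ext w
    have := DFunLike.congr_fun h0 (FreeMonoid.toList w)
    rw [Finsupp.mapDomain_apply FreeMonoid.toList.injective, Finsupp.mapRange_apply] at this
    exact (algebraMap k K).injective (this.trans (map_zero _).symm)
  rw [hm, map_zero]

end SkewWords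

/-! ### Elimination of a conjugating unit -/

section Conjugates

variable {k B : Type*} [Field k] [Ring B] [Algebra k B]

/-- Let `u = 2 y₊ - 1` and `w = 2 y₋ - 1` with `w u = 1`, where `y₊ = y 1` and `y₋ = y (-1)`. In a
product `y₊ a p a`, where `p` is a noncommutative polynomial in `a` and `u a w`, the elements `u` and
`w` can be eliminated in favour of `y₊` and `y₋`, each of them followed by a positive power of `a`. -/
theorem mul_mem_adjoin_of_conj (y : ℤˣ → B) (a u w : B) (hu : u = 2 * y 1 - 1)
    (hw : w = 2 * y (-1) - 1) (hwu : w * u = 1) (p : B)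
    (hp : p ∈ Algebra.adjoin k ({a, u * a * w} : Set B)) :
    y 1 * (a * p * a) ∈
      Algebra.adjoin k (Set.range fun z : ℤˣ × ℕ => y z.1 * a ^ (z.2 + 1)) := by
  set R := Algebra.adjoin k (Set.range fun z : ℤˣ × ℕ => y z.1 * a ^ (z.2 + 1))
  have hgen : ∀ ε n, y ε * a ^ (n + 1) ∈ R := fun ε n => Algebra.subset_adjoin ⟨(ε, n), rfl⟩
  -- The subspace of all `b` that may follow a factor `y ε * a ^ (n + 1)`.
  let T : Submodule k B :=
    { carrier := {b | ∀ ε n, y ε * a ^ (n + 1) * b ∈ R}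
      add_mem' := fun hb hc ε n => by rw [mul_add]; exact add_mem (hb ε n) (hc ε n)
      zero_mem' := fun ε n => by rw [mul_zero]; exact zero_mem _
      smul_mem' := fun r b hb ε n => by rw [mul_smul_comm]; exact R.smul_mem (hb ε n) r }
  have hRT : ∀ b ∈ R, b ∈ T := fun b hb ε n => mul_mem (hgen ε n) hb
  have haT : ∀ b ∈ T, a * b ∈ T := fun b hb ε n => by
    rw [← mul_assoc, mul_assoc (y ε), ← pow_succ]; exact hb ε (n + 1)
  have hyT : ∀ ε, ∀ b ∈ T, (2 * y ε - 1) * (a * b) ∈ T := fun ε b hb => by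
    have h := hRT _ (hb ε 0)
    rw [zero_add, pow_one, mul_assoc] at h
    rw [sub_mul, one_mul, mul_assoc, two_mul]
    exact T.sub_mem (T.add_mem h h) (haT b hb)
  have huT : ∀ b ∈ T, u * (a * b) ∈ T := hu ▸ hyT 1
  have hwT : ∀ b ∈ T, w * (a * b) ∈ T := hw ▸ hyT (-1)
  have hmul : ∀ q ∈ Algebra.adjoin k ({a, u * a * w} : Set B), ∀ b, b ∈ T → w * b ∈ T →
      q * b ∈ T ∧ w * (q * b) ∈ T := by
    intro q hq
    induction hq using Algebra.adjoin_induction with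
    | mem q hq =>
      rintro b hb hwb
      rcases hq with rfl | rfl
      · exact ⟨haT b hb, hwT b hb⟩
      · rw [mul_assoc (u * a), mul_assoc u, ← mul_assoc w, hwu, one_mul]
        exact ⟨huT _ hwb, haT _ hwb⟩
    | algebraMap r =>
      intro b hb hwb
      rw [← Algebra.smul_def, mul_smul_comm]
      exact ⟨T.smul_mem r hb, T.smul_mem r hwb⟩
    | add p q _ _ hp hq =>
      intro b hb hwb
      rw [add_mul, mul_add]
      exact ⟨T.add_mem (hp b hb hwb).1 (hq b hb hwb).1, T.add_mem (hp b hb hwb).2 (hq b hb hwb).2⟩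
    | mul p q _ _ hp hq =>
      intro b hb hwb
      rw [mul_assoc]
      exact hp _ (hq b hb hwb).1 (hq b hb hwb).2
  have h1 : (1 : B) ∈ T := hRT 1 (one_mem R)
  have ha : a ∈ T := by simpa using haT 1 h1
  have h := (hmul p hp a ha (by simpa using hwT 1 h1)).1 1 0
  simpa only [zero_add, pow_one, mul_assoc] using h

end Conjugates

/-! ### A free conjugate pair of endomorphisms -/

section ShiftModel

variable (k : Type*) [Field k]

/-- The automorphism `x n ↦ x (n + m)` of the free algebra on `x n`, `n ∈ ℤ`. -/
noncomputable def freeShift (m : ℤ) : FreeAlgebra k ℤ →ₐ[k] FreeAlgebra k ℤ :=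
  FreeAlgebra.lift k fun n => FreeAlgebra.ι k (n + m)

theorem freeShift_freeShift (m n : ℤ) (h : m + n = 0) (p : FreeAlgebra k ℤ) :
    freeShift k m (freeShift k n p) = p := by
  have h1 : (freeShift k m).comp (freeShift k n) = AlgHom.id k _ := by
    ext i
    simp [freeShift, add_assoc, add_comm n m, h]
  exact DFunLike.congr_fun h1 p

/-- Left multiplication by `x 0` and its conjugate by the shift are left multiplications by the free
generators `x 0` and `x 1`. -/
theorem lift_mulLeft_conj (p : FreeAlgebra k (Fin 2)) :
    FreeAlgebra.lift k ![LinearMap.mulLeft k (FreeAlgebra.ι k (0 : ℤ)),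
        (freeShift k 1).toLinearMap * LinearMap.mulLeft k (FreeAlgebra.ι k (0 : ℤ)) *
          (freeShift k (-1)).toLinearMap] p =
      LinearMap.mulLeft k (FreeAlgebra.lift k
        ![FreeAlgebra.ι k (0 : ℤ), FreeAlgebra.ι k (1 : ℤ)] p) := by
  have h : FreeAlgebra.lift k ![LinearMap.mulLeft k (FreeAlgebra.ι k (0 : ℤ)),
        (freeShift k 1).toLinearMap * LinearMap.mulLeft k (FreeAlgebra.ι k (0 : ℤ)) *
          (freeShift k (-1)).toLinearMap] =
      (Algebra.lmul k (FreeAlgebra k ℤ)).comp (FreeAlgebra.lift k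
        ![FreeAlgebra.ι k (0 : ℤ), FreeAlgebra.ι k (1 : ℤ)]) := by
    ext i : 2
    rw [Function.comp_apply, Function.comp_apply, FreeAlgebra.lift_ι_apply, AlgHom.comp_apply,
      FreeAlgebra.lift_ι_apply]
    fin_cases i
    · rfl
    · refine LinearMap.ext fun q => ?_
      change freeShift k 1 (FreeAlgebra.ι k 0 * freeShift k (-1) q) = FreeAlgebra.ι k 1 * q
      rw [map_mul, freeShift_freeShift k 1 (-1) (by norm_num)]
      simp [freeShift]
  exact DFunLike.congr_fun h p

/-- A nonzero noncommutative polynomial `p` satisfies `(1 + shift) (x₀ p(x₀, x₁) x₀) ≠ 0`: when `x₀`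
is replaced by `0`, only `x₁ p(x₁, x₂) x₁` remains. -/
theorem eq_zero_of_add_freeShift_eq_zero (p : FreeAlgebra k (Fin 2))
    (h : FreeAlgebra.ι k (0 : ℤ) * FreeAlgebra.lift k
        ![FreeAlgebra.ι k (0 : ℤ), FreeAlgebra.ι k (1 : ℤ)] p * FreeAlgebra.ι k (0 : ℤ) +
      freeShift k 1 (FreeAlgebra.ι k (0 : ℤ) * FreeAlgebra.lift k
        ![FreeAlgebra.ι k (0 : ℤ), FreeAlgebra.ι k (1 : ℤ)] p * FreeAlgebra.ι k (0 : ℤ)) = 0) :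
    p = 0 := by
  let κ : FreeAlgebra k ℤ →ₐ[k] FreeAlgebra k (Fin 2) := FreeAlgebra.lift k fun n =>
    if n = 1 then FreeAlgebra.ι k 0 else if n = 2 then FreeAlgebra.ι k 1 else 0
  have hκ : κ (freeShift k 1 (FreeAlgebra.lift k
      ![FreeAlgebra.ι k (0 : ℤ), FreeAlgebra.ι k (1 : ℤ)] p)) = p := by
    have : (κ.comp (freeShift k 1)).comp (FreeAlgebra.lift k
        ![FreeAlgebra.ι k (0 : ℤ), FreeAlgebra.ι k (1 : ℤ)]) = AlgHom.id k _ := by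
      ext i
      fin_cases i <;> simp [κ, freeShift]
    exact DFunLike.congr_fun this p
  have h1 := congrArg κ h
  rw [map_add, map_mul, map_mul, map_mul, map_mul, map_mul, map_mul, hκ] at h1
  have h0 : κ (FreeAlgebra.ι k 0) = 0 := by simp [κ]
  have h2 : κ (freeShift k 1 (FreeAlgebra.ι k 0)) = FreeAlgebra.ι k 0 := by simp [κ, freeShift]
  rw [h0, h2, mul_zero, zero_add, map_zero] at h1
  have hι : FreeAlgebra.ι k (0 : Fin 2) ≠ 0 := FreeAlgebra.ι_ne_zero 0
  simpa [hι] using h1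

end ShiftModel

/-! ### Freeness of an element and its conjugate -/

section Freeness

/-- If the elements `y ε * a ^ (n + 1)` freely generate an algebra, and `w = 2 * y (-1) - 1` is a left
inverse of `u = 2 * y 1 - 1`, then `a` and `u * a * w` generate a free algebra. By
`mul_mem_adjoin_of_conj` in a product of two algebras, a relation `p` between them entails that
`y 1 * a * p * a` vanishes for any other pair formed in the same way, such as left multiplication by
`x 0` and its conjugate by the shift of the `x n`, `n ∈ ℤ`. -/
theorem lift_conj_injective {k D : Type*} [Field k] [CharZero k] [Ring D] [Algebra k D]
    (y : ℤˣ → D) (a u w : D) (hu : u = 2 * y 1 - 1) (hw : w = 2 * y (-1) - 1) (hwu : w * u = 1)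
    (hfree : Function.Injective (FreeAlgebra.lift k fun z : ℤˣ × ℕ => y z.1 * a ^ (z.2 + 1))) :
    Function.Injective (FreeAlgebra.lift k ![a, u * a * w]) := by
  rw [injective_iff_map_eq_zero]
  intro p hp
  let E := Module.End k (FreeAlgebra k ℤ)
  let a₂ : E := LinearMap.mulLeft k (FreeAlgebra.ι k (0 : ℤ))
  let sh : ℤ → E := fun m => (freeShift k m).toLinearMap
  let y₂ : ℤˣ → E := fun ε => (1 / 2 : k) • (1 + sh ε)
  have hy₂ : ∀ ε : ℤˣ, sh ε = 2 * y₂ ε - 1 := fun ε => by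
    simp only [y₂]
    rw [two_mul, ← add_smul, add_halves, one_smul, add_sub_cancel_left]
  have hsh : sh (-1) * sh 1 = 1 := LinearMap.ext fun q =>
    freeShift_freeShift k (-1) 1 (by norm_num) q
  let Y : ℤˣ → D × E := fun ε => (y ε, y₂ ε)
  let A : D × E := (a, a₂)
  let U : D × E := (u, sh 1)
  let W : D × E := (w, sh (-1))
  have hp' : FreeAlgebra.lift k ![A, U * A * W] p ∈
      Algebra.adjoin k ({A, U * A * W} : Set (D × E)) := by
    rw [← Matrix.range_cons_cons_empty A (U * A * W) ![], Algebra.adjoin_range_eq_range_freeAlgebra_lift]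
    exact ⟨p, rfl⟩
  have hmem := mul_mem_adjoin_of_conj Y A U W
    (Prod.ext hu (hy₂ 1)) (Prod.ext hw (hy₂ (-1))) (Prod.ext hwu hsh) _ hp'
  rw [Algebra.adjoin_range_eq_range_freeAlgebra_lift] at hmem
  obtain ⟨N, hN⟩ := hmem
  have hfst : (AlgHom.fst k D E).comp (FreeAlgebra.lift k ![A, U * A * W]) =
      FreeAlgebra.lift k ![a, u * a * w] := by
    ext i
    fin_cases i <;> simp [A, U, W]
  have hsnd : (AlgHom.snd k D E).comp (FreeAlgebra.lift k ![A, U * A * W]) =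
      FreeAlgebra.lift k ![a₂, sh 1 * a₂ * sh (-1)] := by
    ext i : 2
    fin_cases i <;> simp [A, U, W]
  have hN0 : N = 0 := by
    refine (injective_iff_map_eq_zero _).1 hfree N ?_
    have h1 : (AlgHom.fst k D E).comp (FreeAlgebra.lift k fun z : ℤˣ × ℕ =>
        Y z.1 * A ^ (z.2 + 1)) = FreeAlgebra.lift k fun z : ℤˣ × ℕ => y z.1 * a ^ (z.2 + 1) := by
      ext z
      simp [Y, A]
    rw [← h1]
    refine (congrArg Prod.fst hN).trans ?_
    have h2 : (FreeAlgebra.lift k ![A, U * A * W] p).1 = 0 := (DFunLike.congr_fun hfst p).trans hp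
    change y 1 * (a * (FreeAlgebra.lift k ![A, U * A * W] p).1 * a) = 0
    rw [h2, mul_zero, zero_mul, mul_zero]
  rw [hN0, map_zero] at hN
  have h3 : y₂ 1 * (a₂ * (FreeAlgebra.lift k ![A, U * A * W] p).2 * a₂) = 0 :=
    (congrArg Prod.snd hN).symm
  have h4 : (FreeAlgebra.lift k ![A, U * A * W] p).2 = LinearMap.mulLeft k (FreeAlgebra.lift k
      ![FreeAlgebra.ι k (0 : ℤ), FreeAlgebra.ι k (1 : ℤ)] p) :=
    (DFunLike.congr_fun hsnd p).trans (lift_mulLeft_conj k p)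
  rw [h4] at h3
  apply eq_zero_of_add_freeShift_eq_zero k p
  have h5 := LinearMap.congr_fun h3 1
  rw [smul_mul_assoc, LinearMap.smul_apply, LinearMap.zero_apply,
    smul_eq_zero_iff_right (by norm_num)] at h5
  change FreeAlgebra.ι k 0 * (FreeAlgebra.lift k ![FreeAlgebra.ι k (0 : ℤ), FreeAlgebra.ι k (1 : ℤ)] p *
    (FreeAlgebra.ι k 0 * 1)) + freeShift k 1 (FreeAlgebra.ι k 0 * (FreeAlgebra.lift k
      ![FreeAlgebra.ι k (0 : ℤ), FreeAlgebra.ι k (1 : ℤ)] p * (FreeAlgebra.ι k 0 * 1))) = 0 at h5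
  rwa [mul_one, ← mul_assoc] at h5

end Freeness

/-! ### The division ring of fractions of `U(M)` -/

section EnvelopingFractions

open Polynomial

/-- The extension to rational functions of an injective homomorphism from polynomials to a division
ring. -/
noncomputable def liftFrac {k D : Type*} [Field k] [DivisionRing D] (φ : k[X] →+* D)
    (hφ : Function.Injective φ) : FractionRing k[X] →+* D :=
  OreLocalization.universalHom φ
    { toFun := fun s => Units.mk0 (φ s)
        (fun h => nonZeroDivisors.coe_ne_zero s (hφ (h.trans (map_zero φ).symm)))
      map_one' := by ext; simp
      map_mul' := fun a b => by ext; simp }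
    (fun _ => rfl)

theorem liftFrac_algebraMap {k D : Type*} [Field k] [DivisionRing D] (φ : k[X] →+* D)
    (hφ : Function.Injective φ) (p : k[X]) : liftFrac φ hφ (algebraMap _ _ p) = φ p :=
  OreLocalization.universalHom_commutes _ _ _

/-- An affine change of the generators preserves freeness. -/
theorem lift_add_smul_injective {k A I : Type*} [Field k] [Ring A] [Algebra k A] (g : I → A)
    (α β : k) (hβ : β ≠ 0) (hg : Function.Injective (FreeAlgebra.lift k g)) :
    Function.Injective (FreeAlgebra.lift k fun i => algebraMap k A α + β • g i) := by
  let θ : FreeAlgebra k I →ₐ[k] FreeAlgebra k I :=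
    FreeAlgebra.lift k fun i => algebraMap k _ α + β • FreeAlgebra.ι k i
  let θ' : FreeAlgebra k I →ₐ[k] FreeAlgebra k I :=
    FreeAlgebra.lift k fun i => β⁻¹ • (FreeAlgebra.ι k i - algebraMap k _ α)
  have hθ : θ'.comp θ = AlgHom.id k _ := by
    ext i
    simp [θ, θ', hβ]
  have h : (FreeAlgebra.lift k fun i => algebraMap k A α + β • g i) =
      (FreeAlgebra.lift k g).comp θ := by
    ext i
    simp [θ]
  rw [h, AlgHom.coe_comp]
  exact hg.comp (Function.LeftInverse.injective (g := θ') (DFunLike.congr_fun hθ))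

/-- The powers of `1 / ((X - 1/3) (X + 1/3))` satisfy the independence condition on the `v i` in
`lift_signInv_mul_injective`. -/
theorem eq_zero_of_sum_poleFrac_pow {k : Type*} [Field k] [CharZero k] (r : ℕ →₀ k)
    (c : FractionRing k[X]) (ε : ℤˣ)
    (h : (r.sum fun i r => algebraMap k (FractionRing k[X]) r * poleFrac k ^ (i + 1)) =
      c - (ε : ℤ) * shiftFrac k c) : r = 0 := by
  have hε : ((ε : ℤ) : k) ≠ 0 := Int.cast_ne_zero.2 ε.ne_zero
  have hp : r.sum (fun i r => monomial i r) = (0 : k[X]) := by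
    refine eq_zero_of_aeval_poleFrac_eq _ _ hε c ?_
    rw [map_intCast, ← h, map_finsuppSum, Finsupp.sum_mul]
    simp only [aeval_monomial, pow_succ, mul_assoc]
  ext i
  have := congrArg (coeff · i) hp
  simpa [Finsupp.sum, coeff_monomial] using this

variable {k : Type*} [Field k] {M : Type*} [LieRing M] [LieAlgebra k M]
  [IsNoncommPlane k M]

namespace LieFractions

variable (b : Module.Basis (Fin 2) k M)

/-- The homomorphism `p ↦ p(e)` from polynomials to `𝔇(M)`, with `e = b 0`. -/
noncomputable def polyEmb : k[X] →ₐ[k] LieFractions k M :=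
  (ofEnveloping k M).comp (aeval (UniversalEnvelopingAlgebra.ι k (b 0)))

theorem polyEmb_X : polyEmb b X = ofLie k M (b 0) := by
  rw [polyEmb, AlgHom.comp_apply, aeval_X]; rfl

variable {b}

theorem polyEmb_injective (hb : ⁅b 0, b 1⁆ = b 1) : Function.Injective (polyEmb b) := by
  refine (ofEnveloping_injective k M).comp fun p q h => ?_
  have h0 : ∀ p : k[X], IsNoncommPlane.normalForm b (C p) =
      aeval (UniversalEnvelopingAlgebra.ι k (b 0)) p := fun p => by
    simpa using IsNoncommPlane.normalForm_monomial b 0 p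
  change aeval _ p = aeval _ q at h
  rw [← h0, ← h0] at h
  exact C_injective (IsNoncommPlane.normalForm_injective b hb h)

/-- The embedding `g ↦ g(e)` of the field of rational functions into `𝔇(M)`, with `e = b 0`. -/
noncomputable def fracEmb (hb : ⁅b 0, b 1⁆ = b 1) : FractionRing k[X] →+* LieFractions k M :=
  liftFrac (polyEmb b).toRingHom (polyEmb_injective hb)

theorem fracEmb_algebraMap (hb : ⁅b 0, b 1⁆ = b 1) (p : k[X]) : fracEmb hb (algebraMap _ _ p) = polyEmb b p :=
  liftFrac_algebraMap _ (polyEmb_injective hb) p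

theorem fracEmb_const (hb : ⁅b 0, b 1⁆ = b 1) (r : k) : fracEmb hb (algebraMap k _ r) = algebraMap k _ r := by
  rw [IsScalarTower.algebraMap_apply k k[X], fracEmb_algebraMap, AlgHom.commutes]

theorem ofLie_mul_polyEmb (hb : ⁅b 0, b 1⁆ = b 1) (p : k[X]) :
    ofLie k M (b 1) * polyEmb b p = polyEmb b (p.comp (X - C 1)) * ofLie k M (b 1) := by
  have h := congrArg (ofEnveloping k M) (IsNoncommPlane.f_mul_aeval b hb p)
  rw [map_mul, map_mul] at h
  exact h

/-- Conjugation by `f = b 1` shifts rational functions of `e = b 0`. -/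
theorem ofLie_mul_fracEmb (hb : ⁅b 0, b 1⁆ = b 1) (g : FractionRing k[X]) :
    ofLie k M (b 1) * fracEmb hb g = fracEmb hb (shiftFrac k g) * ofLie k M (b 1) := by
  obtain ⟨n, d, hd, rfl⟩ := IsFractionRing.div_surjective k[X] g
  have hd0 : algebraMap k[X] (FractionRing k[X]) d ≠ 0 :=
    IsFractionRing.to_map_ne_zero_of_mem_nonZeroDivisors hd
  have h : ∀ p : k[X], ofLie k M (b 1) * fracEmb hb (algebraMap _ _ p) =
      fracEmb hb (shiftFrac k (algebraMap _ _ p)) * ofLie k M (b 1) := fun p => by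
    rw [shiftFrac_algebraMap, fracEmb_algebraMap, fracEmb_algebraMap, ofLie_mul_polyEmb hb]
  have h1 : fracEmb hb (algebraMap _ _ d) ≠ 0 := (_root_.map_ne_zero _).2 hd0
  rw [map_div₀, map_div₀, map_div₀]
  apply mul_right_cancel₀ h1
  have hcomm : (fracEmb hb (shiftFrac k (algebraMap _ _ n)) /
      fracEmb hb (shiftFrac k (algebraMap _ _ d))) * fracEmb hb (shiftFrac k (algebraMap _ _ d)) =
      fracEmb hb (shiftFrac k (algebraMap _ _ n)) :=
    div_mul_cancel₀ _ ((_root_.map_ne_zero _).2 ((_root_.map_ne_zero _).2 hd0))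
  rw [mul_assoc, div_mul_cancel₀ _ h1, mul_assoc _ (ofLie k M (b 1)), h d, ← mul_assoc, hcomm, h]

/-- The powers of `f = b 1` are left linearly independent over the rational functions of `e`. -/
theorem eq_zero_of_eval₂_fracEmb (hb : ⁅b 0, b 1⁆ = b 1) (q : (FractionRing k[X])[X])
    (hq : q.eval₂ (fracEmb hb) (ofLie k M (b 1)) = 0) : q = 0 := by
  obtain ⟨c, hc, hP⟩ := IsLocalization.integerNormalization_spec k[X]⁰ q
  set P := IsLocalization.integerNormalization k[X]⁰ q
  have hnf : ∀ P : k[X][X], (P.map (algebraMap k[X] (FractionRing k[X]))).eval₂ (fracEmb hb)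
      (ofLie k M (b 1)) = ofEnveloping k M (IsNoncommPlane.normalForm b P) := by
    intro P
    induction P using Polynomial.induction_on' with
    | add P Q hP hQ => rw [Polynomial.map_add, eval₂_add, hP, hQ, map_add, map_add]
    | monomial n p =>
      rw [map_monomial, eval₂_monomial, fracEmb_algebraMap, ← C_mul_X_pow_eq_monomial,
        IsNoncommPlane.normalForm_monomial, map_mul, map_pow]
      rfl
  have hc0 : algebraMap k[X] (FractionRing k[X]) c ≠ 0 :=
    IsFractionRing.to_map_ne_zero_of_mem_nonZeroDivisors hc
  have hsmul : c • q = C (algebraMap k[X] (FractionRing k[X]) c) * q := by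
    ext i : 1
    rw [coeff_smul, coeff_C_mul, Algebra.smul_def]
  have h := hnf P
  rw [hP, hsmul, eval₂_C_mul_skew, hq, mul_zero] at h
  have hP0 : P = 0 := IsNoncommPlane.normalForm_injective b hb
    ((ofEnveloping_injective k M (h.symm.trans (map_zero _).symm)).trans (map_zero _).symm)
  rw [hP0, Polynomial.map_zero, hsmul, eq_comm, mul_eq_zero, C_eq_zero] at hP
  exact hP.resolve_left hc0

theorem one_add_ofLie_ne_zero (hb : ⁅b 0, b 1⁆ = b 1) (ε : ℤˣ) :
    1 + ((ε : ℤ) : LieFractions k M) * ofLie k M (b 1) ≠ 0 :=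
  one_add_mul_ne_zero (eq_zero_of_eval₂_fracEmb hb) ε

/-- The rational function `1 / ((e - 1/3) (e + 1/3))` and its conjugate by `(1 - f) (1 + f)⁻¹` generate
a free algebra. -/
theorem lift_poleFrac_injective [CharZero k] (hb : ⁅b 0, b 1⁆ = b 1) (u : LieFractions k M)
    (hu : u = (1 - ofLie k M (b 1)) * (1 + ofLie k M (b 1))⁻¹) :
    Function.Injective (FreeAlgebra.lift k
      ![fracEmb hb (poleFrac k), u * fracEmb hb (poleFrac k) * u⁻¹]) := by
  set x := ofLie k M (b 1)
  have h1 : 1 + x ≠ 0 := by simpa using one_add_ofLie_ne_zero hb 1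
  have h2 : 1 - x ≠ 0 := by simpa [sub_eq_add_neg] using one_add_ofLie_ne_zero hb (-1)
  have hu0 : u ≠ 0 := by rw [hu]; exact mul_ne_zero h2 (inv_ne_zero h1)
  have e1 : u = 2 * signInv x 1 - 1 := by
    have : (1 - x) = 2 - (1 + x) := by rw [← one_add_one_eq_two]; abel
    rw [hu, this, sub_mul, mul_inv_cancel₀ h1]
    simp [signInv]
  have e2 : u⁻¹ = 2 * signInv x (-1) - 1 := by
    have : (1 + x) = 2 - (1 - x) := by rw [← one_add_one_eq_two]; abel
    rw [hu, mul_inv_rev, inv_inv, this, sub_mul, mul_inv_cancel₀ h2]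
    simp [signInv, sub_eq_add_neg]
  refine lift_conj_injective (signInv x) _ u u⁻¹ e1 e2 (inv_mul_cancel₀ hu0) ?_
  have h := lift_signInv_mul_injective (k := k) (fun i : ℕ => poleFrac k ^ (i + 1))
    (fracEmb_const hb) (ofLie_mul_fracEmb hb) (eq_zero_of_eval₂_fracEmb hb)
    (fun _ => exists_const_of_shiftFrac_eq) (fun _ => eq_zero_of_shiftFrac_eq_neg)
    eq_zero_of_sum_poleFrac_pow
  simpa only [map_pow] using h

/-- With `c = 1/3` and `s = (e - c) (e + c)⁻¹` one has `s + s⁻¹ = 2 + (2 c)² / ((e - c) (e + c))`. -/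
theorem add_inv_eq_fracEmb [CharZero k] (hb : ⁅b 0, b 1⁆ = b 1) (s : LieFractions k M)
    (hs : s = (ofLie k M (b 0) - algebraMap k _ (1 / 3)) *
      (ofLie k M (b 0) + algebraMap k _ (1 / 3))⁻¹) :
    s + s⁻¹ = algebraMap k _ 2 + (4 / 9 : k) • fracEmb hb (poleFrac k) := by
  let c : FractionRing k[X] := algebraMap k _ (1 / 3)
  let t : FractionRing k[X] := algebraMap k[X] _ X
  have hinj := IsFractionRing.injective k[X] (FractionRing k[X])
  have hc : c = algebraMap k[X] _ (C (1 / 3)) := IsScalarTower.algebraMap_apply k k[X] _ _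
  have h1 : t - c ≠ 0 := by
    rw [hc, ← map_sub]; exact (map_ne_zero_iff _ hinj).2 (X_sub_C_ne_zero _)
  have h2 : t + c ≠ 0 := by
    rw [hc, ← map_add]; exact (map_ne_zero_iff _ hinj).2 (X_add_C_ne_zero _)
  have hpole : poleFrac k = ((t - c) * (t + c))⁻¹ := by
    rw [poleFrac, poleDenom, map_mul, map_sub, map_add, ← hc]
  have ht : fracEmb hb t = ofLie k M (b 0) := by rw [fracEmb_algebraMap, polyEmb_X]
  have hs' : s = fracEmb hb ((t - c) * (t + c)⁻¹) := by
    rw [hs, map_mul, map_inv₀, map_sub, map_add, ht, fracEmb_const]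
  rw [hs', ← map_inv₀, ← map_add, Algebra.smul_def, ← fracEmb_const hb, ← fracEmb_const hb,
    ← map_mul, ← map_add, hpole]
  congr 1
  have h49 : algebraMap k (FractionRing k[X]) (4 / 9) = (2 * c) ^ 2 := by
    rw [← map_ofNat (algebraMap k (FractionRing k[X])) 2, ← map_mul, ← map_pow]
    norm_num
  rw [h49, map_ofNat]
  field_simp
  ring

end LieFractions

end EnvelopingFractions

/-! ### Symmetry under the principal involution -/

section Symmetry

namespace LieFractions

variable {k : Type*} [Field k] {L : Type*} [LieRing L] [LieAlgebra k L]
  [IsOreDomain (UniversalEnvelopingAlgebra k L)]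

theorem principalInvolution_algebraMap (r : k) :
    principalInvolution k L (algebraMap k _ r) = algebraMap k _ r := by
  rw [← (ofEnveloping k L).commutes, principalInvolution_ofEnveloping, AlgHom.commutes,
    MulOpposite.algebraMap_apply, MulOpposite.unop_op]

/-- If `x` is skew-symmetric and `c` is a scalar, then `(x - c) (x + c)⁻¹` is unitary. -/
theorem principalInvolution_cayley (x : LieFractions k L) (hx : principalInvolution k L x = -x)
    (r : k) :
    principalInvolution k L ((x - algebraMap k _ r) * (x + algebraMap k _ r)⁻¹) =
      ((x - algebraMap k _ r) * (x + algebraMap k _ r)⁻¹)⁻¹ := by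
  have hcomm : Commute (x - algebraMap k _ r) (x + algebraMap k _ r) := by
    have h : Commute x (algebraMap k (LieFractions k L) r) := Algebra.commute_algebraMap_right r x
    exact ((Commute.refl x).add_right h).sub_left (h.symm.add_right (Commute.refl _))
  rw [principalInvolution_mul, principalInvolution_inv, map_sub, map_add,
    principalInvolution_algebraMap, hx, mul_inv_rev, inv_inv, ← neg_add', neg_add_eq_sub,
    ← neg_sub x, inv_neg, neg_mul_neg, (hcomm.symm.inv_right₀).eq]

end LieFractions

end Symmetry

theorem mainTheorem6 (k : Type*) [Field k] [CharZero k] (M : Type*) [LieRing M] [LieAlgebra k M]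
    [IsNoncommPlane k M] :
    (∃ b : Module.Basis (Fin 2) k M, ⁅b 0, b 1⁆ = b 1) ∧
    ∀ b : Module.Basis (Fin 2) k M, ⁅b 0, b 1⁆ = b 1 →
      ∀ e f s u S T : LieFractions k M,
        e = LieFractions.ofLie k M (b 0) →
        f = LieFractions.ofLie k M (b 1) →
        s = (e - algebraMap k (LieFractions k M) (1 / 3)) *
          (e + algebraMap k (LieFractions k M) (1 / 3))⁻¹ →
        u = (1 - f) * (1 + f)⁻¹ →
        S = s + s⁻¹ →
        T = u * (s + s⁻¹) * u⁻¹ →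
        (LieFractions.principalInvolution k M S = S ∧
          LieFractions.principalInvolution k M T = T) ∧
        Function.Injective (FreeAlgebra.lift k ![S, T]) := by
  refine ⟨IsNoncommPlane.exists_basis k M, ?_⟩
  rintro b hb e f s u S T rfl rfl hs hu rfl rfl
  have hs' : LieFractions.principalInvolution k M s = s⁻¹ := by
    rw [hs]
    exact LieFractions.principalInvolution_cayley _
      (LieFractions.principalInvolution_ofLie k M _) _
  -- `u` is the negative of the Cayley transform `(f - 1) (f + 1)⁻¹`.
  have hu' : LieFractions.principalInvolution k M u = u⁻¹ := by
    have h := LieFractions.principalInvolution_cayley _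
      (LieFractions.principalInvolution_ofLie k M (b 1)) 1
    rw [map_one (algebraMap k (LieFractions k M))] at h
    rw [hu, ← neg_sub, neg_mul, add_comm, map_neg, h, inv_neg]
  have hS : LieFractions.principalInvolution k M (s + s⁻¹) = s + s⁻¹ := by
    rw [map_add, LieFractions.principalInvolution_inv, hs', inv_inv, add_comm]
  refine ⟨⟨hS, ?_⟩, ?_⟩
  · rw [LieFractions.principalInvolution_mul, LieFractions.principalInvolution_mul,
      LieFractions.principalInvolution_inv, hS, hu', inv_inv, mul_assoc]
  · have hu0 : u ≠ 0 := by
      have h1 := LieFractions.one_add_ofLie_ne_zero hb 1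
      have h2 := LieFractions.one_add_ofLie_ne_zero hb (-1)
      rw [hu]
      exact mul_ne_zero (by simpa [sub_eq_add_neg] using h2) (inv_ne_zero (by simpa using h1))
    have h := lift_add_smul_injective _ 2 (4 / 9 : k) (by norm_num)
      (LieFractions.lift_poleFrac_injective hb u hu)
    convert h using 3
    funext i
    rw [LieFractions.add_inv_eq_fracEmb hb s hs]
    fin_cases i
    · rfl
    · change u * (algebraMap k _ 2 + (4 / 9 : k) • _) * u⁻¹ = algebraMap k _ 2 + (4 / 9 : k) • _
      rw [mul_add, add_mul, ← Algebra.commutes, mul_assoc _ u, mul_inv_cancel₀ hu0, mul_one,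
        mul_smul_comm, smul_mul_assoc]
      rfl
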